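/- Let $K$ be an algebraically closed field of characteristic $0$, and let $\mathcal C\subseteq \mathbb A^n=K^n$ be a smooth affine algebraic curve (a Zariski closed set all of whose irreducible components have dimension $1$ and whose local ring at every point is regular). Suppose that $\mathcal C$ has a rational parametric representation, i.e. rational functions $\mathcal P=(P_1,\dots,P_n)\in K(t)^n$ that define a dominant map $\mathbb A^1\dashrightarrow\mathcal C$ (at every $t$ where all $P_i$ are defined, $\mathcal P(t)\in\mathcal C$, and these points are Zariski dense in $\mathcal C$), such that for some non-empty Zariski open set $\mathcal U\subseteq\mathbb A^1$ on which $\mathcal P$ is defined: (P1) $\mathcal P$ is injective on $\mathcal U$; (P2) $\mathcal P'(t)\neq 0$ for every $t\in\mathcal U$. Let $T\mathcal C=\{(x,y)\in\mathbb A^{2n} : x\in\mathcal C,\ \nabla f(x)\cdot y=0 \text{ for all } f\in I(\mathcal C)\}$ be the tangent bundle of $\mathcal C$. Then the geometric degrees of $\mathcal C$ and of $T\mathcal C$ satisfy $$\deg(T\mathcal C)\le 3\deg(\mathcal C)-2.$$ Here the geometric degree of an irreducible affine variety of dimension $d$ is the number of points of its intersection with almost every (i.e. a generic) linear variety of codimension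 $d$ (this intersection being finite), and the geometric degree of an arbitrary affine variety is the sum of the degrees of its irreducible components. -/

import Mathlib

open MvPolynomial

noncomputable section

/-! ### Affine algebraic varieties in `K ^ σ` -/

section Varieties

variable {K : Type*} [Field K] {σ : Type*}

/-- `V` is an algebraic variety (not necessarily irreducible): the set of common zeros of all
polynomials vanishing on `V`, i.e. `V` is Zariski closed. -/
def IsAlgVariety (V : Set (σ → K)) : Prop :=
  zeroLocus K (vanishingIdeal K V) = V

/-- `Z` is an irreducible algebraic variety (in particular it is non-empty). -/
def IsIrredVariety (Z : Set (σ → K)) : Prop :=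
  IsAlgVariety Z ∧ (vanishingIdeal K Z).IsPrime

/-- The irreducible components of `V`: the maximal irreducible varieties contained in `V`. -/
def irredComponents (V : Set (σ → K)) : Set (Set (σ → K)) :=
  {Z | Maximal (fun W : Set (σ → K) => IsIrredVariety W ∧ W ⊆ V) Z}

/-- The coordinate ring `K[V] = K[x] / I(V)`. -/
abbrev CoordRing (V : Set (σ → K)) : Type _ :=
  MvPolynomial σ K ⧸ vanishingIdeal K V

/-- The dimension of a variety: the Krull dimension of its coordinate ring. -/
def varietyDim (V : Set (σ → K)) : WithBot ℕ∞ :=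
  ringKrullDim (CoordRing V)

/-- An algebraic curve: an algebraic variety all of whose irreducible components have
dimension one. -/
def IsAlgCurve (V : Set (σ → K)) : Prop :=
  IsAlgVariety V ∧ ∀ Z ∈ irredComponents V, varietyDim Z = 1

/-- Evaluation of regular functions on `V` at a point `p` of `V`. -/
def evalAtPoint (V : Set (σ → K)) (p : V) : CoordRing V →ₐ[K] K :=
  Ideal.Quotient.liftₐ (vanishingIdeal K V) (aeval (p : σ → K)) fun _ hf => hf p p.2

instance evalAtPoint_ker_isPrime (V : Set (σ → K)) (p : V) :
    (RingHom.ker (evalAtPoint V p)).IsPrime :=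
  RingHom.ker_isPrime _

/-- The local ring of `V` at `p`: the localization of `K[V]` at the maximal ideal of the regular
functions vanishing at `p`. -/
abbrev LocalRingAt (V : Set (σ → K)) (p : V) : Type _ :=
  Localization.AtPrime (RingHom.ker (evalAtPoint V p))

/-- `V` is smooth: its local ring at every point is a regular local ring. -/
def IsSmoothVariety (V : Set (σ → K)) : Prop :=
  ∀ p : V, IsRegularLocalRing (LocalRingAt V p)

variable [Fintype σ]

/-- The tangent space `T_p V ⊆ K ^ σ`: all `y` with `∇ f (p) ⬝ y = 0` for every `f ∈ I(V)`. -/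
def tangentSpaceAt (V : Set (σ → K)) (p : σ → K) : Set (σ → K) :=
  {y | ∀ f ∈ vanishingIdeal K V, ∑ i, eval p (pderiv i f) * y i = 0}

/-- The tangent bundle `T V ⊆ K ^ (σ ⊕ σ)`: all pairs `(x, y)` with `x ∈ V` and `y ∈ T_x V`. -/
def tangentBundle (V : Set (σ → K)) : Set (σ ⊕ σ → K) :=
  {z | (fun i => z (Sum.inl i)) ∈ V ∧
    (fun i => z (Sum.inr i)) ∈ tangentSpaceAt V (fun i => z (Sum.inl i))}

/-! ### Geometric degree -/

/-- The common zeros of the `d` polynomials `a i none + ∑ j, a i (some j) * x j` of degree at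
most one. -/
def linearSection {d : ℕ} (a : Fin d → Option σ → K) : Set (σ → K) :=
  {x | ∀ i, a i none + ∑ j, a i (some j) * x j = 0}

/-- The irreducible variety `Z` has degree `δ`: with `d = dim Z`, for almost all linear varieties
`L` of codimension `d` the set `Z ∩ L` is finite with exactly `δ` points. "Almost all" means:
for all coefficients `a` of the `d` equations of `L` outside the zero set of some non-zero
polynomial `F` in these coefficients; there the equations are also required to be independent,
so that `L` does have codimension `d`. -/
def IsDegreeOfIrred (Z : Set (σ → K)) (δ : ℕ) : Prop :=
  ∃ d : ℕ, varietyDim Z = d ∧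
    ∃ F : MvPolynomial (Fin d × Option σ) K, F ≠ 0 ∧
      ∀ a : Fin d → Option σ → K, eval (fun q => a q.1 q.2) F ≠ 0 →
        LinearIndependent K (fun i => fun j : σ => a i (some j)) ∧
        (Z ∩ linearSection a).Finite ∧ (Z ∩ linearSection a).ncard = δ

/-- The algebraic variety `V` has geometric degree `δ`: `δ` is the sum of the degrees of its
(finitely many) irreducible components. -/
def IsGeometricDegree (V : Set (σ → K)) (δ : ℕ) : Prop :=
  IsAlgVariety V ∧ (irredComponents V).Finite ∧
    ∃ deg : Set (σ → K) → ℕ,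
      (∀ Z ∈ irredComponents V, IsDegreeOfIrred Z (deg Z)) ∧
      δ = ∑ᶠ Z ∈ irredComponents V, deg Z

/-- The degree of an irreducible variety is unique. -/
theorem IsDegreeOfIrred.unique [Infinite K] {Z : Set (σ → K)} {δ δ' : ℕ}
    (h : IsDegreeOfIrred Z δ) (h' : IsDegreeOfIrred Z δ') : δ = δ' := by
  obtain ⟨d, hd, F, hF, H⟩ := h
  obtain ⟨d', hd', F', hF', H'⟩ := h'
  obtain rfl : d = d' := by
    have h1 := hd.symm.trans hd'
    exact_mod_cast h1
  have hne : F * F' ≠ 0 := mul_ne_zero hF hF'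
  obtain ⟨x, hx⟩ : ∃ x, eval x (F * F') ≠ 0 := by
    by_contra! hcon
    exact hne (MvPolynomial.funext fun x => by simpa using hcon x)
  rw [map_mul] at hx
  have e1 := (H (fun i j => x (i, j)) (left_ne_zero_of_mul hx)).2.2
  have e2 := (H' (fun i j => x (i, j)) (right_ne_zero_of_mul hx)).2.2
  exact e1.symm.trans e2

/-- The geometric degree is unique. -/
theorem IsGeometricDegree.unique [Infinite K] {V : Set (σ → K)} {δ δ' : ℕ}
    (h : IsGeometricDegree V δ) (h' : IsGeometricDegree V δ') : δ = δ' := by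
  obtain ⟨-, -, f, hf, rfl⟩ := h
  obtain ⟨-, -, f', hf', rfl⟩ := h'
  exact finsum_mem_congr rfl fun Z hZ => (hf Z hZ).unique (hf' Z hZ)

end Varieties

/-! ### Rational parametric representations -/

section Parametrizations

variable {K : Type*} [Field K] {n : ℕ}

/-- The points of the affine line where all the rational functions `P i` are defined. -/
def ratDomain (P : Fin n → RatFunc K) : Set K :=
  {t | ∀ i, (P i).denom.eval t ≠ 0}

/-- The value `P(t)` of the tuple of rational functions `P`, for `t` in its domain. -/
def ratValue (P : Fin n → RatFunc K) (t : K) : Fin n → K :=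
  fun i => (P i).num.eval t / (P i).denom.eval t

/-- The derivative `P'(t)` of the tuple of rational functions `P`, for `t` in its domain
(by the quotient rule). -/
def ratDeriv (P : Fin n → RatFunc K) (t : K) : Fin n → K :=
  fun i => ((P i).num.derivative.eval t * (P i).denom.eval t
    - (P i).num.eval t * (P i).denom.derivative.eval t) / (P i).denom.eval t ^ 2

/-- `P` is a rational parametric representation of `C`: it defines a map from its domain to `C`
whose image is Zariski dense in `C`. -/
def IsRatParametrization (P : Fin n → RatFunc K) (C : Set (Fin n → K)) : Prop :=
  Set.MapsTo (ratValue P) (ratDomain P) C ∧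
    C ⊆ zeroLocus K (vanishingIdeal K (ratValue P '' ratDomain P))

/-- `U` is a non-empty Zariski open subset of the affine line (over an infinite field). -/
def IsNonemptyOpenOfLine (U : Set K) : Prop :=
  ∃ q : Polynomial K, q ≠ 0 ∧ U = {t | q.eval t ≠ 0}

/-- Conditions (P1) and (P2): `P` is defined and injective on some non-empty open subset `U` of
the affine line, and its derivative does not vanish at any point of `U`. -/
def SatisfiesP1P2 (P : Fin n → RatFunc K) : Prop :=
  ∃ U : Set K, IsNonemptyOpenOfLine U ∧ U ⊆ ratDomain P ∧
    Set.InjOn (ratValue P) U ∧ ∀ t ∈ U, ratDeriv P t ≠ 0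

end Parametrizations

end

/-! Write the parametrization as `p i / q` with no common zero, and let `D` be the largest degree
among `q` and the `p i`. A generic hyperplane pulls back to a linear combination of `q` and the `p
i`. This has degree `D` and simple roots, and its roots avoid the finitely many bad parameters. The
parametrization is injective there and misses only finitely many points of `C`, which a generic
hyperplane avoids. Hence `deg C = D`.

Smoothness makes the tangent spaces lines that are locally generated by a regular vector field. So
no part of `T C` sits over a missed point alone: the points `(P(t), s P'(t))` are dense in `T C`,
which is therefore irreducible, with function ring inside `K(t, s)`, and of dimension 2. On these
points two generic linear equations become `q A_k + s B_k = 0`, with `A_k` of degree at most `D`.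
The `B_k` are combinations of the Wronskians of `q` and `p i`; the top terms cancel, so their degree
is at most `2 D - 2`. Eliminating `s` leaves `A_0 B_1 - A_1 B_0 = 0`, which has at most `3 D - 2`
roots, and each relevant root determines `s`.

The main supports are `generic_ncard_roots` (root counts are generically constant),
`IsCurveParam.coeff_eq` (only the point at infinity can be missed), `exists_tangent_frame`
(smoothness) and `natDegree_wronskian_le` (the degree drop). -/

noncomputable section

universe u

/-! ### Properties that hold for generic coefficients -/

section Generic

variable {K : Type*} [Field K] {τ : Type*}

/-- A property of points of `K ^ τ` holds generically if it holds outside the zero set of some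
non-zero polynomial. -/
def Generic (Q : (τ → K) → Prop) : Prop :=
  ∃ F : MvPolynomial τ K, F ≠ 0 ∧ ∀ a, eval a F ≠ 0 → Q a

theorem Generic.mono {Q Q' : (τ → K) → Prop} (h : Generic Q) (h' : ∀ a, Q a → Q' a) :
    Generic Q' := by
  obtain ⟨F, hF, H⟩ := h
  exact ⟨F, hF, fun a ha => h' a (H a ha)⟩

theorem Generic.and {Q Q' : (τ → K) → Prop} (h : Generic Q) (h' : Generic Q') :
    Generic fun a => Q a ∧ Q' a := by
  obtain ⟨F, hF, H⟩ := h
  obtain ⟨F', hF', H'⟩ := h'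
  refine ⟨F * F', mul_ne_zero hF hF', fun a ha => ?_⟩
  rw [map_mul] at ha
  exact ⟨H a (left_ne_zero_of_mul ha), H' a (right_ne_zero_of_mul ha)⟩

theorem Generic.forall_mem_finite {ι : Type*} {s : Set ι} (hs : s.Finite)
    {Q : ι → (τ → K) → Prop} (h : ∀ i ∈ s, Generic (Q i)) :
    Generic fun a => ∀ i ∈ s, Q i a := by
  choose! F hF H using h
  refine ⟨∏ i ∈ hs.toFinset, F i, Finset.prod_ne_zero_iff.2 fun i hi => hF i (by simpa using hi),
    fun a ha i hi => H i hi a ?_⟩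
  rw [map_prod, Finset.prod_ne_zero_iff] at ha
  exact ha i (by simpa using hi)

theorem generic_eval_ne_zero {F : MvPolynomial τ K} (a : τ → K) (h : eval a F ≠ 0) :
    Generic fun a => eval a F ≠ 0 :=
  ⟨F, fun h0 => h (by simp [h0]), fun _ h => h⟩

theorem Generic.exists [Infinite K] {Q : (τ → K) → Prop} (h : Generic Q) : ∃ a, Q a := by
  obtain ⟨F, hF, H⟩ := h
  by_contra! hcon
  exact hF (MvPolynomial.funext fun x => by
    simpa using not_imp_comm.1 (H x) (hcon x))

/-- A generic property fails only finitely often on a generic line parallel to a coordinate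
axis. -/
theorem Generic.finite_not_update [DecidableEq τ] {Q : (τ → K) → Prop} (h : Generic Q) (i : τ) :
    Generic fun a => {c : K | ¬ Q (Function.update a i c)}.Finite := by
  obtain ⟨F, hF, H⟩ := h
  refine ⟨F, hF, fun a ha => ?_⟩
  let f : Polynomial K :=
    aeval (fun j => if j = i then Polynomial.X else Polynomial.C (a j)) F
  have hf : ∀ c, f.eval c = eval (Function.update a i c) F := by
    intro c
    have : (Polynomial.evalRingHom c).comp (aeval (R := K)
        (fun j => if j = i then (Polynomial.X : Polynomial K) else Polynomial.C (a j))).toRingHom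
        = eval (Function.update a i c) := by
      ext j
      · simp
      · by_cases hj : j = i
        · subst hj; simp
        · simp [hj]
    exact RingHom.congr_fun this F
  have hf0 : f ≠ 0 := by
    intro h0
    apply ha
    have := hf (a i)
    rw [h0, Function.update_eq_self] at this
    simpa using this.symm
  classical
  refine (f.roots.toFinset.finite_toSet).subset fun c hc => ?_
  have : eval (Function.update a i c) F = 0 := not_imp_comm.1 (H _) hc
  simp [hf0, hf, this]

end Generic

/-! ### Root counts in families of univariate polynomials -/

section RootCount

open Polynomial

theorem exists_map_eq_C_mul {R : Type*} [CommRing R] [IsDomain R] (L : Type*) [Field L]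
    [Algebra R L] [IsFractionRing R L] (x : L[X]) :
    ∃ c : R, c ≠ 0 ∧ ∃ y : R[X], y.map (algebraMap R L) = Polynomial.C (algebraMap R L c) * x := by
  obtain ⟨b, hb, h⟩ := IsLocalization.integerNormalization_spec (nonZeroDivisors R) x
  refine ⟨b, nonZeroDivisors.ne_zero hb, _, h.trans ?_⟩
  rw [← Polynomial.smul_eq_C_mul, algebraMap_smul]

variable {K : Type*} [Field K] {τ : Type*}

/-- Over a domain of characteristic zero, a non-zero polynomial has the same roots as a separable
one, up to denominators. -/
theorem exists_separable_multiple {R : Type*} [CommRing R] [IsDomain R] [CharZero R]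
    {f : R[X]} (hf : f ≠ 0) :
    ∃ (H u v k k' : R[X]) (r c c' : R) (m : ℕ), r ≠ 0 ∧ c ≠ 0 ∧ c' ≠ 0 ∧ H ≠ 0 ∧
      u * H + v * derivative H = Polynomial.C r ∧ H * k = Polynomial.C c * f ∧
      f * k' = Polynomial.C c' * H ^ m := by
  let L := FractionRing R
  have : CharZero L := charZero_of_injective_algebraMap (IsFractionRing.injective R L)
  have inj : Function.Injective (Polynomial.map (algebraMap R L)) :=
    Polynomial.map_injective _ (IsFractionRing.injective R L)
  set fL := f.map (algebraMap R L) with hfL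
  have hfL0 : fL ≠ 0 := (Polynomial.map_ne_zero_iff (IsFractionRing.injective R L)).2 hf
  classical
  -- The radical keeps the roots of `fL`; it is squarefree, hence separable since `L` is perfect.
  -- The rest clears denominators to return to `R`.
  set ρ := UniqueFactorizationMonoid.radical fL with hρ
  have hsq : Squarefree ρ := UniqueFactorizationMonoid.squarefree_radical
  have hsep : ρ.Separable := PerfectField.separable_iff_squarefree.2 hsq
  have hρ0 : ρ ≠ 0 := hsq.ne_zero
  obtain ⟨b, hb, H, hH⟩ := exists_map_eq_C_mul (R := R) L ρ
  have hbL : algebraMap R L b ≠ 0 :=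
    (map_ne_zero_iff _ (IsFractionRing.injective R L)).2 hb
  have hbU : IsUnit (Polynomial.C (algebraMap R L b)) := Polynomial.isUnit_C.2 hbL.isUnit
  have hHsep : (H.map (algebraMap R L)).Separable := by
    rw [hH]; exact hsep.unit_mul hbU
  obtain ⟨u, v, huv⟩ := hHsep
  have hdvd : H.map (algebraMap R L) ∣ fL := by
    rw [hH, hbU.mul_left_dvd]; exact UniqueFactorizationMonoid.radical_dvd_self
  obtain ⟨k, hk⟩ := hdvd
  obtain ⟨m, hm⟩ : ∃ m, fL ∣ ρ ^ m := by
    refine ⟨(UniqueFactorizationMonoid.normalizedFactors fL).card, ?_⟩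
    refine (UniqueFactorizationMonoid.prod_normalizedFactors hfL0).dvd_iff_dvd_left.1 ?_
    have key : ∀ s : Multiset L[X], (∀ x ∈ s, x ∣ ρ) → s.prod ∣ ρ ^ s.card := by
      intro s
      induction s using Multiset.induction_on with
      | empty => simp
      | cons x s ih =>
        intro hs
        rw [Multiset.prod_cons, Multiset.card_cons, pow_succ']
        exact mul_dvd_mul (hs x (by simp)) (ih fun y hy => hs y (by simp [hy]))
    exact key _ fun x hx =>
      (UniqueFactorizationMonoid.dvd_radical_iff_of_irreducible
        (UniqueFactorizationMonoid.irreducible_of_normalized_factor x hx) hfL0).2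
        (UniqueFactorizationMonoid.dvd_of_mem_normalizedFactors hx)
  have hm' : fL ∣ (H.map (algebraMap R L)) ^ m := by
    rw [hH, mul_pow]; exact hm.mul_left _
  obtain ⟨k', hk'⟩ := hm'
  obtain ⟨cu, hcu, U, hU⟩ := exists_map_eq_C_mul (R := R) L u
  obtain ⟨cv, hcv, V, hV⟩ := exists_map_eq_C_mul (R := R) L v
  obtain ⟨c, hc, κ, hκ⟩ := exists_map_eq_C_mul (R := R) L k
  obtain ⟨c', hc', κ', hκ'⟩ := exists_map_eq_C_mul (R := R) L k'
  refine ⟨H, Polynomial.C cv * U, Polynomial.C cu * V, κ, κ', cu * cv, c, c', m,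
    mul_ne_zero hcu hcv, hc, hc', ?_, ?_, ?_, ?_⟩
  · rintro rfl
    rw [Polynomial.map_zero] at hH
    exact mul_ne_zero hbU.ne_zero hρ0 hH.symm
  · apply inj
    simp only [Polynomial.map_add, Polynomial.map_mul, hU, hV, Polynomial.map_C, map_mul,
      ← Polynomial.derivative_map]
    linear_combination (Polynomial.C (algebraMap R L cu) * Polynomial.C (algebraMap R L cv)) * huv
  · apply inj
    simp only [Polynomial.map_mul, hκ, Polynomial.map_C, ← hfL, hk]
    ring
  · apply inj
    simp only [Polynomial.map_mul, hκ', Polynomial.map_C, ← hfL, Polynomial.map_pow, hk']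
    ring

theorem ncard_roots_of_separable [IsAlgClosed K] {f : K[X]} (hf : f.Separable) :
    {t | f.eval t = 0}.ncard = f.natDegree := by
  classical
  have h1 : {t | f.eval t = 0} = (f.roots.toFinset : Set K) := by
    ext t; simp [hf.ne_zero]
  rw [h1, Set.ncard_coe_finset, Multiset.toFinset_card_of_nodup (Polynomial.nodup_roots hf)]
  exact (IsAlgClosed.splits f).natDegree_eq_card_roots.symm

theorem finite_eval_eq_zero {f : K[X]} (hf : f ≠ 0) : {t | f.eval t = 0}.Finite := by
  classical
  exact (f.roots.toFinset.finite_toSet).subset fun t ht => by simpa [hf] using ht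

theorem ncard_eval_eq_zero_le {f : K[X]} (hf : f ≠ 0) :
    {t | f.eval t = 0}.ncard ≤ f.natDegree := by
  classical
  have h1 : {t | f.eval t = 0} = (f.roots.toFinset : Set K) := by
    ext t; simp [hf]
  rw [h1, Set.ncard_coe_finset]
  exact (Multiset.toFinset_card_le _).trans f.card_roots'

/-- The number of roots of a polynomial with polynomial coefficients is generically constant. -/
theorem generic_ncard_roots [IsAlgClosed K] [CharZero K] {f : (MvPolynomial τ K)[X]} (hf : f ≠ 0) :
    ∃ δ : ℕ, Generic fun a : τ → K =>
      f.map (MvPolynomial.eval a) ≠ 0 ∧ {t | (f.map (MvPolynomial.eval a)).eval t = 0}.ncard = δ := by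
  obtain ⟨H, u, v, k, k', r, c, c', m, hr, hc, hc', hH0, huv, hk, hk'⟩ :=
    exists_separable_multiple hf
  -- Off the zeros of this product, `f` stays non-zero, `H` keeps its degree and its separability
  -- (`r`), and `f` and `H` keep the same roots (`c`, `c'`).
  refine ⟨H.natDegree, r * c * c' * H.leadingCoeff * f.leadingCoeff,
    by simp [hr, hc, hc', hH0, hf], fun a ha => ?_⟩
  simp only [map_mul, ne_eq, mul_eq_zero, not_or] at ha
  obtain ⟨⟨⟨⟨har, hac⟩, hac'⟩, hlc⟩, hlf⟩ := ha
  set φ := MvPolynomial.eval a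
  have hdeg : (H.map φ).natDegree = H.natDegree := Polynomial.natDegree_map_of_leadingCoeff_ne_zero _ hlc
  have e1 : H.map φ * k.map φ = Polynomial.C (φ c) * f.map φ := by
    simpa using congrArg (Polynomial.map φ) hk
  have e2 : f.map φ * k'.map φ = Polynomial.C (φ c') * H.map φ ^ m := by
    simpa using congrArg (Polynomial.map φ) hk'
  have e3 : u.map φ * H.map φ + v.map φ * derivative (H.map φ) = Polynomial.C (φ r) := by
    simpa [Polynomial.derivative_map] using congrArg (Polynomial.map φ) huv
  have hsep : (H.map φ).Separable := by
    refine ⟨Polynomial.C (φ r)⁻¹ * u.map φ, Polynomial.C (φ r)⁻¹ * v.map φ, ?_⟩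
    rw [mul_assoc, mul_assoc, ← mul_add, e3, ← Polynomial.C_mul, inv_mul_cancel₀ har, Polynomial.C_1]
  refine ⟨fun h0 => hlf ?_, ?_⟩
  · have := congrArg (fun p => Polynomial.coeff p f.natDegree) h0
    simpa using this
  have : {t | (f.map φ).eval t = 0} = {t | (H.map φ).eval t = 0} := by
    ext t
    have e1' := congrArg (Polynomial.eval t) e1
    have e2' := congrArg (Polynomial.eval t) e2
    simp only [Polynomial.eval_mul, Polynomial.eval_C, Polynomial.eval_pow] at e1' e2'
    constructor
    · intro h
      simp only [Set.mem_ofPred_eq] at h ⊢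
      rw [h, zero_mul, eq_comm, mul_eq_zero, or_iff_right hac'] at e2'
      exact eq_zero_of_pow_eq_zero e2'
    · intro h
      simp only [Set.mem_ofPred_eq] at h ⊢
      rw [h, zero_mul, eq_comm, mul_eq_zero, or_iff_right hac] at e1'
      exact e1'
  rw [this, ncard_roots_of_separable hsep, hdeg]

/-- The roots of `f` that are not roots of `g` are the roots of `f * g` minus those of `g`, and both
of these counts are generically constant. -/
theorem generic_ncard_roots_diff [IsAlgClosed K] [CharZero K] {f : (MvPolynomial τ K)[X]}
    (hf : f ≠ 0) (g : (MvPolynomial τ K)[X]) :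
    ∃ δ : ℕ, Generic fun a : τ → K =>
      {t | (f.map (MvPolynomial.eval a)).eval t = 0 ∧ (g.map (MvPolynomial.eval a)).eval t ≠ 0}.Finite ∧
      {t | (f.map (MvPolynomial.eval a)).eval t = 0 ∧
        (g.map (MvPolynomial.eval a)).eval t ≠ 0}.ncard = δ := by
  by_cases hg : g = 0
  · refine ⟨0, 1, one_ne_zero, fun a _ => ?_⟩
    simp [hg]
  obtain ⟨δ, h⟩ := generic_ncard_roots (mul_ne_zero hf hg)
  obtain ⟨δ', h'⟩ := generic_ncard_roots hg
  refine ⟨δ - δ', (h.and h').mono ?_⟩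
  rintro a ⟨⟨h0, h⟩, h0', h'⟩
  have hset : {t | (f.map (MvPolynomial.eval a)).eval t = 0 ∧
      (g.map (MvPolynomial.eval a)).eval t ≠ 0} =
      {t | ((f * g).map (MvPolynomial.eval a)).eval t = 0} \
        {t | (g.map (MvPolynomial.eval a)).eval t = 0} := by
    ext t
    simp only [Polynomial.map_mul, Polynomial.eval_mul, Set.mem_ofPred_eq, Set.mem_sdiff]
    constructor
    · rintro ⟨h1, h2⟩; exact ⟨by simp [h1], h2⟩
    · rintro ⟨h1, h2⟩; exact ⟨(mul_eq_zero.1 h1).resolve_right h2, h2⟩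
  rw [hset]
  refine ⟨(finite_eval_eq_zero h0).subset Set.sdiff_subset, ?_⟩
  rw [Set.ncard_sdiff ?_ (finite_eval_eq_zero h0'), h, h']
  intro t ht
  simp only [Set.mem_ofPred_eq] at ht
  simp [ht]

theorem generic_ncard_common_roots_diff [IsAlgClosed K] [CharZero K] {f : (MvPolynomial τ K)[X]}
    (hf : f ≠ 0) (h g : (MvPolynomial τ K)[X]) :
    ∃ δ : ℕ, Generic fun a : τ → K =>
      {t | (f.map (MvPolynomial.eval a)).eval t = 0 ∧ (h.map (MvPolynomial.eval a)).eval t = 0 ∧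
        (g.map (MvPolynomial.eval a)).eval t ≠ 0}.Finite ∧
      {t | (f.map (MvPolynomial.eval a)).eval t = 0 ∧ (h.map (MvPolynomial.eval a)).eval t = 0 ∧
        (g.map (MvPolynomial.eval a)).eval t ≠ 0}.ncard = δ := by
  obtain ⟨δ, H⟩ := generic_ncard_roots_diff hf g
  obtain ⟨δ', H'⟩ := generic_ncard_roots_diff hf (h * g)
  refine ⟨δ - δ', (H.and H').mono ?_⟩
  rintro a ⟨⟨h0, h1⟩, h0', h1'⟩
  rw [show {t | (f.map (MvPolynomial.eval a)).eval t = 0 ∧ (h.map (MvPolynomial.eval a)).eval t = 0 ∧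
      (g.map (MvPolynomial.eval a)).eval t ≠ 0} =
      {t | (f.map (MvPolynomial.eval a)).eval t = 0 ∧ (g.map (MvPolynomial.eval a)).eval t ≠ 0} \
      {t | (f.map (MvPolynomial.eval a)).eval t = 0 ∧
        ((h * g).map (MvPolynomial.eval a)).eval t ≠ 0} by
    ext t
    simp only [Polynomial.map_mul, Polynomial.eval_mul, Set.mem_ofPred_eq, Set.mem_sdiff, ne_eq,
      mul_eq_zero]
    tauto]
  refine ⟨h0.subset Set.sdiff_subset, ?_⟩
  rw [Set.ncard_sdiff ?_ h0', h1, h1']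
  rintro t ⟨ht, ht'⟩
  refine ⟨ht, fun h2 => ht' ?_⟩
  simp [h2]

end RootCount

/-! ### Curves parametrized by polynomials over a common denominator -/

section Parametrized

open Polynomial

/-- `F` is `f` at `p / q` with denominators cleared. One `F` serves every target `L`: it will be
specialized to points of `K`, to fraction fields and to dual numbers. -/
theorem exists_homogenization {K B : Type u} [Field K] [CommRing B] [Algebra K B] {σ : Type*}
    (p : σ → B) (q : B) (f : MvPolynomial σ K) :
    ∃ (F : B) (N : ℕ), ∀ (L : Type u) [CommRing L] [Algebra K L] (ψ : B →ₐ[K] L) (x : σ → L),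
      (∀ i, x i * ψ q = ψ (p i)) → ψ F = ψ q ^ N * MvPolynomial.aeval x f := by
  induction f using MvPolynomial.induction_on with
  | C a =>
    refine ⟨algebraMap K B a, 0, fun L _ _ ψ x hx => ?_⟩
    simp [MvPolynomial.algHom_C]
  | add f g hf hg =>
    obtain ⟨F, N, hF⟩ := hf
    obtain ⟨G, M, hG⟩ := hg
    refine ⟨q ^ M * F + q ^ N * G, N + M, fun L _ _ ψ x hx => ?_⟩
    simp only [map_add, map_mul, map_pow, hF L ψ x hx, hG L ψ x hx]
    ring
  | mul_X f i hf =>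
    obtain ⟨F, N, hF⟩ := hf
    refine ⟨F * p i, N + 1, fun L _ _ ψ x hx => ?_⟩
    simp only [map_mul, hF L ψ x hx, ← hx i, MvPolynomial.aeval_X]
    ring

/-- The vanishing ideal of the image of a dense set of points under a rational map is the kernel
of the pull-back of functions. -/
theorem vanishingIdeal_range_eq_ker {K B : Type u} [Field K] [CommRing B] [IsDomain B]
    [Algebra K B] {σ : Type*} {ι : Type*} (ψ : ι → B →ₐ[K] K)
    (hψ : ∀ b, (∀ i, ψ i b = 0) → b = 0) (p : σ → B) (q : B) (hq : ∀ i, ψ i q ≠ 0) :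
    vanishingIdeal K (Set.range fun i j => ψ i (p j) / ψ i q) =
      RingHom.ker (MvPolynomial.aeval (R := K) (fun j =>
        algebraMap B (FractionRing B) (p j) / algebraMap B (FractionRing B) q)) := by
  have hq0 : q ≠ 0 := by
    rintro rfl
    exact one_ne_zero (hψ 1 fun i => absurd (map_zero _) (hq i))
  have hqL : algebraMap B (FractionRing B) q ≠ 0 :=
    (map_ne_zero_iff _ (IsFractionRing.injective B (FractionRing B))).2 hq0
  ext f
  obtain ⟨F, N, hF⟩ := exists_homogenization p q f
  have h1 := hF (FractionRing B) (IsScalarTower.toAlgHom K B (FractionRing B))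
    (fun j => algebraMap B (FractionRing B) (p j) / algebraMap B (FractionRing B) q)
    (fun i => div_mul_cancel₀ _ hqL)
  have h2 := fun i => hF K (ψ i) (fun j => ψ i (p j) / ψ i q)
    (fun j => div_mul_cancel₀ _ (hq i))
  rw [RingHom.mem_ker, mem_vanishingIdeal_iff, Set.forall_mem_range]
  have e1 : (∀ i, MvPolynomial.aeval (fun j => ψ i (p j) / ψ i q) f = 0) ↔ F = 0 := by
    constructor
    · intro h
      exact hψ F fun i => by rw [h2 i, h i, mul_zero]
    · rintro rfl i
      have := h2 i
      rw [map_zero, eq_comm, mul_eq_zero] at this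
      exact this.resolve_left (pow_ne_zero _ (hq i))
  rw [e1]
  simp only [IsScalarTower.coe_toAlgHom'] at h1
  constructor
  · rintro rfl
    rw [map_zero, eq_comm, mul_eq_zero] at h1
    exact h1.resolve_left (pow_ne_zero _ hqL)
  · intro h
    rw [h, mul_zero] at h1
    exact (map_eq_zero_iff _ (IsFractionRing.injective B (FractionRing B))).1 h1

theorem exists_common_denominator {K : Type*} [Field K] {n : ℕ} (P : Fin n → RatFunc K) :
    ∃ (p : Fin n → K[X]) (q : K[X]), q ≠ 0 ∧ (∀ t, q.eval t = 0 → ∃ i, (p i).eval t ≠ 0) ∧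
      ∀ i, p i * (P i).denom = (P i).num * q := by
  classical
  -- A common denominator of least degree has no zero in common with all numerators, since a common
  -- linear factor could be cancelled.
  have hex : ∃ d, ∃ (p : Fin n → K[X]) (q : K[X]), q ≠ 0 ∧ q.natDegree = d ∧
      ∀ i, p i * (P i).denom = (P i).num * q := by
    refine ⟨_, fun i => (P i).num * ∏ j ∈ Finset.univ.erase i, (P j).denom, ∏ j, (P j).denom,
      Finset.prod_ne_zero_iff.2 fun j _ => (P j).denom_ne_zero, rfl, fun i => ?_⟩
    rw [mul_assoc, Finset.prod_erase_mul _ _ (Finset.mem_univ i)]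
  obtain ⟨p, q, hq, hd, h⟩ := Nat.find_spec hex
  refine ⟨p, q, hq, fun t ht => ?_, h⟩
  by_contra! hcon
  obtain ⟨q', rfl⟩ := Polynomial.dvd_iff_isRoot.2 ht
  choose p' hp' using fun i => Polynomial.dvd_iff_isRoot.2 (hcon i)
  have hX : (Polynomial.X - Polynomial.C t : K[X]) ≠ 0 := Polynomial.X_sub_C_ne_zero t
  have hq' : q' ≠ 0 := right_ne_zero_of_mul hq
  refine Nat.find_min hex (m := q'.natDegree) ?_ ⟨p', q', hq', rfl, fun i => ?_⟩
  · rw [← hd, Polynomial.natDegree_mul hX hq', Polynomial.natDegree_X_sub_C]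
    omega
  · apply mul_left_cancel₀ hX
    have := h i
    rw [hp' i] at this
    linear_combination this

variable {K : Type u} [Field K] {σ : Type*}

/-- The point with coordinates `p i (t) / q (t)`. -/
def curvePoint (p : σ → K[X]) (q : K[X]) (t : K) : σ → K :=
  fun i => (p i).eval t / q.eval t

/-- The derivative of `curvePoint p q` at `t`. -/
def curveTangent (p : σ → K[X]) (q : K[X]) (t : K) : σ → K :=
  fun i => (wronskian q (p i)).eval t / q.eval t ^ 2

/-- The variety `C` is parametrized by the rational functions `p i / q`, without common factor,
and outside the zeros of `r` this parametrization is defined, injective and unramified. -/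
structure IsCurveParam (C : Set (σ → K)) (p : σ → K[X]) (q r : K[X]) : Prop where
  closed : IsAlgVariety C
  r_ne : r ≠ 0
  no_common : ∀ t, q.eval t = 0 → ∃ i, (p i).eval t ≠ 0
  q_ne : ∀ t, r.eval t ≠ 0 → q.eval t ≠ 0
  mem : ∀ t, q.eval t ≠ 0 → curvePoint p q t ∈ C
  dense : C ⊆ zeroLocus K (vanishingIdeal K (curvePoint p q '' {t | q.eval t ≠ 0}))
  inj : Set.InjOn (curvePoint p q) {t | r.eval t ≠ 0}
  tangent : ∀ t, r.eval t ≠ 0 → curveTangent p q t ≠ 0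

/-- The degree of the homogeneous parametrization given by `p` and `q`. -/
def curveDeg [Fintype σ] (p : σ → K[X]) (q : K[X]) : ℕ :=
  max q.natDegree (Finset.univ.sup fun i => (p i).natDegree)

theorem exists_isCurveParam {n : ℕ} {C : Set (Fin n → K)} (hC : IsAlgVariety C)
    {P : Fin n → RatFunc K} (hP : IsRatParametrization P C) (hP12 : SatisfiesP1P2 P) :
    ∃ p q r, IsCurveParam C p q r := by
  obtain ⟨p, q, hq, hpq, h⟩ := exists_common_denominator P
  obtain ⟨U, ⟨r, hr, rfl⟩, hU, hinj, htan⟩ := hP12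
  have hev : ∀ i t, (p i).eval t * (P i).denom.eval t = (P i).num.eval t * q.eval t := fun i t => by
    simpa using congrArg (Polynomial.eval t) (h i)
  have hdom : ratDomain P = {t | q.eval t ≠ 0} := by
    ext t
    constructor
    · intro ht hqt
      obtain ⟨i, hi⟩ := hpq t hqt
      have := hev i t
      rw [hqt, mul_zero, mul_eq_zero] at this
      exact this.elim hi (ht i)
    · intro hqt i hdt
      have := hev i t
      rw [hdt, mul_zero, eq_comm, mul_eq_zero] at this
      obtain ⟨a, b, hab⟩ := (P i).isCoprime_num_denom
      have h1 := congrArg (Polynomial.eval t) hab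
      simp [this.resolve_right hqt, hdt] at h1
  have hval : ∀ t, t ∈ ratDomain P → curvePoint p q t = ratValue P t := by
    intro t ht
    have hqt : q.eval t ≠ 0 := by rw [hdom] at ht; exact ht
    funext i
    have := hev i t
    have hi := ht i
    rw [curvePoint, ratValue, div_eq_div_iff hqt hi, this]
  have hder : ∀ t, t ∈ ratDomain P → curveTangent p q t = ratDeriv P t := by
    intro t ht
    have hqt : q.eval t ≠ 0 := by rw [hdom] at ht; exact ht
    funext i
    have h0 := hev i t
    have h1 := congrArg (fun f => Polynomial.eval t (derivative f)) (h i)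
    simp only [Polynomial.derivative_mul, Polynomial.eval_add, Polynomial.eval_mul] at h1
    have hi : (P i).denom.eval t ≠ 0 := ht i
    have hp : (p i).eval t = (P i).num.eval t * q.eval t / (P i).denom.eval t := by
      rw [eq_div_iff hi, h0]
    have hp' : (derivative (p i)).eval t = ((derivative (P i).num).eval t * q.eval t +
        (P i).num.eval t * (derivative q).eval t -
        (p i).eval t * (derivative (P i).denom).eval t) / (P i).denom.eval t := by
      rw [eq_div_iff hi]
      linear_combination h1
    simp only [curveTangent, ratDeriv, wronskian, Polynomial.eval_sub, Polynomial.eval_mul]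
    rw [hp', hp]
    field_simp
    ring
  have himg : curvePoint p q '' {t | q.eval t ≠ 0} = ratValue P '' ratDomain P := by
    rw [← hdom]
    exact Set.image_congr fun t ht => hval t ht
  refine ⟨p, q, r, hC, hr, hpq, fun t ht => ?_, fun t ht => ?_, ?_, ?_, fun t ht => ?_⟩
  · have := hU ht
    rw [hdom] at this
    exact this
  · have h1 : t ∈ ratDomain P := by rw [hdom]; exact ht
    rw [hval t h1]
    exact hP.1 h1
  · rw [himg]
    exact hP.2
  · intro s hs t ht hst
    rw [hval s (hU hs), hval t (hU ht)] at hst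
    exact hinj hs ht hst
  · rw [hder t (hU ht)]
    exact htan t ht

namespace IsCurveParam

variable {C : Set (σ → K)} {p : σ → K[X]} {q r : K[X]}

theorem q_ne_zero (h : IsCurveParam C p q r) [Infinite K] : q ≠ 0 := by
  rintro rfl
  refine h.r_ne (Polynomial.funext fun t => ?_)
  by_contra ht
  exact h.q_ne t (by simpa using ht) (by simp)

theorem exists_numerator (f : MvPolynomial σ K) : ∃ (F : K[X]) (N : ℕ),
    ∀ t, q.eval t ≠ 0 → F.eval t = q.eval t ^ N * MvPolynomial.aeval (curvePoint p q t) f := by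
  obtain ⟨F, N, hF⟩ := exists_homogenization p q f
  refine ⟨F, N, fun t ht => ?_⟩
  have := hF K (Polynomial.aeval t) (curvePoint p q t) fun i => by
    simp [curvePoint, Polynomial.coe_aeval_eq_eval, div_mul_cancel₀ _ ht]
  simpa [Polynomial.coe_aeval_eq_eval] using this

/-- Density of the curve points survives the removal of finitely many parameters, because the
numerator of `f` along the curve is a polynomial in `t`. -/
theorem mem_vanishingIdeal (h : IsCurveParam C p q r) [Infinite K] {f : MvPolynomial σ K}
    {s : K[X]} (hs : s ≠ 0)
    (hf : ∀ t, s.eval t ≠ 0 → r.eval t ≠ 0 → MvPolynomial.aeval (curvePoint p q t) f = 0) :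
    f ∈ vanishingIdeal K C := by
  obtain ⟨F, N, hF⟩ := exists_numerator (p := p) (q := q) f
  have hF0 : F = 0 := by
    have : F * (r * s) = 0 := Polynomial.funext fun t => by
      by_cases hst : s.eval t = 0
      · simp [hst]
      by_cases hrt : r.eval t = 0
      · simp [hrt]
      simp [hF t (h.q_ne t hrt), hf t hst hrt]
    exact (mul_eq_zero.1 this).resolve_right (mul_ne_zero h.r_ne hs)
  intro x hx
  refine h.dense hx f ?_
  rintro _ ⟨t, ht, rfl⟩
  have := hF t ht
  rw [hF0, Polynomial.eval_zero, eq_comm, mul_eq_zero] at this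
  exact this.resolve_left (pow_ne_zero _ ht)

/-- Pulling back along the parametrization embeds the coordinate ring in the field `K(t)`. -/
theorem isPrime (h : IsCurveParam C p q r) [Infinite K] : (vanishingIdeal K C).IsPrime := by
  have key : vanishingIdeal K C = vanishingIdeal K (Set.range fun (t : {t // q.eval t ≠ 0}) j =>
      Polynomial.aeval (t : K) (p j) / Polynomial.aeval (t : K) q) := by
    apply le_antisymm
    · apply vanishingIdeal_anti_mono
      rintro _ ⟨t, rfl⟩
      exact h.mem t t.2
    · intro f hf
      refine h.mem_vanishingIdeal one_ne_zero fun t _ ht => ?_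
      exact hf _ ⟨⟨t, h.q_ne t ht⟩, rfl⟩
  rw [key, vanishingIdeal_range_eq_ker (fun t : {t // q.eval t ≠ 0} => Polynomial.aeval (t : K))
    _ p q fun t => t.2]
  · exact RingHom.ker_isPrime _
  · intro b hb
    have : b * q = 0 := Polynomial.funext fun t => by
      by_cases ht : q.eval t = 0
      · simp [ht]
      · have := hb ⟨t, ht⟩
        simp only [Polynomial.coe_aeval_eq_eval] at this
        simp [this]
    exact (mul_eq_zero.1 this).resolve_right h.q_ne_zero

theorem isIrredVariety (h : IsCurveParam C p q r) [Infinite K] : IsIrredVariety C :=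
  ⟨h.closed, h.isPrime⟩

end IsCurveParam

theorem exists_eval_ne_zero [Infinite K] {s : K[X]} (hs : s ≠ 0) : ∃ t, s.eval t ≠ 0 := by
  by_contra! hcon
  exact hs (Polynomial.funext fun t => by simpa using hcon t)

theorem irredComponents_of_isIrredVariety {K : Type*} [Field K] {σ : Type*} {V : Set (σ → K)}
    (h : IsIrredVariety V) : irredComponents V = {V} := by
  ext Z
  simp only [irredComponents, Set.mem_singleton_iff]
  constructor
  · intro hZ
    have hZ' : Maximal (fun W => IsIrredVariety W ∧ W ⊆ V) Z := hZ
    exact hZ'.eq_of_le ⟨h, subset_rfl⟩ hZ'.prop.2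
  · rintro rfl
    exact ⟨⟨h, subset_rfl⟩, fun W hW _ => hW.2⟩

/-! ### Points missed by the parametrization -/

section Degree

variable [Fintype σ] {p : σ → K[X]} {q : K[X]}

theorem natDegree_le_curveDeg (i : σ) : (p i).natDegree ≤ curveDeg p q :=
  (Finset.le_sup (f := fun i => (p i).natDegree) (Finset.mem_univ i)).trans (le_max_right _ _)

theorem natDegree_denom_le_curveDeg : q.natDegree ≤ curveDeg p q := le_max_left _ _

/-- Polynomials of the same degree bound without common zeros on the projective line generate all
forms of large degree. -/
theorem exists_bounded_combination [IsAlgClosed K] {e : σ → K[X]} {D : ℕ}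
    (hdeg : ∀ i, (e i).natDegree ≤ D) {i₀ : σ} (h₀ : (e i₀).coeff D ≠ 0)
    (hroot : ∀ t, ∃ i, (e i).eval t ≠ 0) {j : ℕ} (hj : j ≤ 2 * D) :
    ∃ h : σ → K[X], (∀ i, (h i).natDegree ≤ D) ∧ Polynomial.X ^ j = ∑ i, h i * e i := by
  classical
  have hspan : Ideal.span (Set.range e) = ⊤ := by
    obtain ⟨g, hg⟩ := (IsPrincipalIdealRing.principal (Ideal.span (Set.range e))).principal
    rw [Ideal.submodule_span_eq] at hg
    rw [hg, Ideal.span_singleton_eq_top]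
    by_contra hu
    have hdvd : ∀ i, g ∣ e i := fun i => by
      rw [← Ideal.mem_span_singleton, ← hg]
      exact Ideal.subset_span ⟨i, rfl⟩
    have hg0 : g.degree ≠ 0 := by
      intro h0
      exact hu (Polynomial.isUnit_iff_degree_eq_zero.2 h0)
    obtain ⟨t, ht⟩ := IsAlgClosed.exists_root g hg0
    obtain ⟨i, hi⟩ := hroot t
    exact hi (Polynomial.IsRoot.dvd ht (hdvd i))
  obtain ⟨g, hg⟩ := Ideal.mem_span_range_iff_exists_fun.1
    ((Ideal.eq_top_iff_one _).1 hspan)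
  have he0 : e i₀ ≠ 0 := by rintro h; simp [h] at h₀
  have hedeg : (e i₀).natDegree = D :=
    le_antisymm (hdeg i₀) (Polynomial.le_natDegree_of_ne_zero h₀)
  -- Reducing every coefficient except that of `e i₀` modulo `e i₀` bounds its degree by `D`. The
  -- quotients are collected in the coefficient of `e i₀`, whose degree is then forced to be at most
  -- `2 * D - D`.
  set a : σ → K[X] := fun i => (Polynomial.X ^ j * g i) / e i₀ with ha
  set s : σ → K[X] := fun i => (Polynomial.X ^ j * g i) % e i₀ with hs
  have hsum : ∀ i, Polynomial.X ^ j * g i = e i₀ * a i + s i := fun i =>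
    (EuclideanDomain.div_add_mod _ _).symm
  have hsdeg : ∀ i, (s i).natDegree ≤ D := fun i => by
    rw [← hedeg]
    exact Polynomial.natDegree_le_natDegree (Polynomial.degree_mod_lt _ he0).le
  set S : K[X] := ∑ i, a i * e i with hS
  have htot : Polynomial.X ^ j = e i₀ * S + ∑ i, s i * e i := by
    calc Polynomial.X ^ j = Polynomial.X ^ j * ∑ i, g i * e i := by rw [hg, mul_one]
      _ = ∑ i, (Polynomial.X ^ j * g i) * e i := by
        rw [Finset.mul_sum]; exact Finset.sum_congr rfl fun i _ => by ring
      _ = ∑ i, (e i₀ * (a i * e i) + s i * e i) :=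
        Finset.sum_congr rfl fun i _ => by rw [hsum]; ring
      _ = _ := by rw [Finset.sum_add_distrib, ← Finset.mul_sum]
  have hSdeg : S.natDegree ≤ D := by
    by_cases hS0 : S = 0
    · simp [hS0]
    have h1 : (e i₀ * S).natDegree ≤ 2 * D := by
      rw [show e i₀ * S = Polynomial.X ^ j - ∑ i, s i * e i by rw [htot]; ring]
      refine (Polynomial.natDegree_sub_le _ _).trans (max_le (by simpa using hj) ?_)
      refine Polynomial.natDegree_sum_le_of_forall_le _ _ fun i _ => ?_
      refine Polynomial.natDegree_mul_le.trans ?_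
      have := hsdeg i
      have := hdeg i
      omega
    rw [Polynomial.natDegree_mul he0 hS0] at h1
    omega
  refine ⟨fun i => s i + if i = i₀ then S else 0, fun i => ?_, ?_⟩
  · refine (Polynomial.natDegree_add_le _ _).trans (max_le (hsdeg i) ?_)
    split_ifs
    · exact hSdeg
    · simp
  · rw [htot]
    simp only [add_mul, Finset.sum_add_distrib, ite_mul, zero_mul, Finset.sum_ite_eq',
      Finset.mem_univ, if_true]
    ring

/-- A point of the curve which is not the image of a point of the affine line is the image of the
point at infinity. -/
theorem IsCurveParam.coeff_eq [IsAlgClosed K] {C : Set (σ → K)} {r : K[X]}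
    (h : IsCurveParam C p q r) {x : σ → K} (hx : x ∈ C)
    (hne : ∀ t, q.eval t ≠ 0 → curvePoint p q t ≠ x) (i : σ) :
    (p i).coeff (curveDeg p q) = x i * q.coeff (curveDeg p q) := by
  classical
  by_contra hi
  set D := curveDeg p q with hD
  -- A common zero of the `e i` would be a parameter of `x`; a non-zero coefficient in degree `D`
  -- says that infinity is not a common zero either.
  let e : σ → K[X] := fun i => p i - Polynomial.C (x i) * q
  have hdeg : ∀ i, (e i).natDegree ≤ D := fun i =>
    (Polynomial.natDegree_sub_le _ _).trans (max_le (natDegree_le_curveDeg i)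
      ((Polynomial.natDegree_C_mul_le _ _).trans natDegree_denom_le_curveDeg))
  have hroot : ∀ t, ∃ i, (e i).eval t ≠ 0 := by
    intro t
    by_contra! hcon
    simp only [e, Polynomial.eval_sub, Polynomial.eval_mul, Polynomial.eval_C, sub_eq_zero] at hcon
    by_cases hqt : q.eval t = 0
    · obtain ⟨i, hi⟩ := h.no_common t hqt
      exact hi (by rw [hcon i, hqt, mul_zero])
    · exact hne t hqt (funext fun i => by rw [curvePoint, hcon i, mul_div_cancel_right₀ _ hqt])
  have h₀ : (e i).coeff D ≠ 0 := by
    simpa [e, sub_eq_zero] using hi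
  choose w hwdeg hw using fun j : Fin (2 * D + 1) =>
    exists_bounded_combination hdeg h₀ hroot (Nat.lt_succ_iff.1 j.2)
  -- Since `e i = q * (P i - x i)`, the relations `t ^ j = ∑ i, w j i * e i` say that the vector of
  -- powers of `t` is fixed by `N` at `P(t)`. So `det (1 - N)` vanishes on the image, hence on `C`;
  -- but `N` is zero at `x`, where this determinant is 1.
  let N : Matrix (Fin (2 * D + 1)) (Fin (2 * D + 1)) (MvPolynomial σ K) := fun j k =>
    ∑ i, MvPolynomial.C ((q * w j i).coeff k) * (MvPolynomial.X i - MvPolynomial.C (x i))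
  have hN : ∀ y j k, MvPolynomial.eval y (N j k) = ∑ i, (q * w j i).coeff k * (y i - x i) := by
    intro y j k
    simp [N]
  have hdet : ∀ y : σ → K, MvPolynomial.aeval y (1 - N).det =
      (1 - Matrix.of fun j k : Fin (2 * D + 1) =>
        ∑ i, (q * w j i).coeff k * (y i - x i)).det := by
    intro y
    rw [AlgHom.map_det]
    congr 1
    ext j k
    simp [Matrix.map_apply, hN, Matrix.one_apply]
  have hmem : (1 - N).det ∈ vanishingIdeal K (curvePoint p q '' {t | q.eval t ≠ 0}) := by
    rintro _ ⟨t, ht, rfl⟩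
    rw [hdet, ← Matrix.exists_mulVec_eq_zero_iff]
    refine ⟨fun k => t ^ (k : ℕ), fun h0 => ?_, ?_⟩
    · simpa using congrFun h0 0
    · funext j
      rw [Matrix.sub_mulVec, Matrix.one_mulVec, Pi.sub_apply, Pi.zero_apply, sub_eq_zero]
      have hqw : ∀ i, (q * w j i).eval t = ∑ k : Fin (2 * D + 1), (q * w j i).coeff k * t ^ (k : ℕ) := by
        intro i
        rw [Fin.sum_univ_eq_sum_range (fun k => (q * w j i).coeff k * t ^ k)]
        refine Polynomial.eval_eq_sum_range' ?_ t
        refine Nat.lt_succ_iff.2 (Polynomial.natDegree_mul_le.trans ?_)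
        have h1 := hwdeg j i
        have h2 : q.natDegree ≤ D := natDegree_denom_le_curveDeg
        omega
      have hj := congrArg (Polynomial.eval t) (hw j)
      simp only [Polynomial.eval_pow, Polynomial.eval_X, Polynomial.eval_finsetSum,
        Polynomial.eval_mul] at hj
      rw [hj]
      simp only [Matrix.mulVec, dotProduct, Matrix.of_apply, Finset.sum_mul]
      rw [Finset.sum_comm]
      refine Finset.sum_congr rfl fun i _ => ?_
      have h3 : (e i).eval t = q.eval t * (curvePoint p q t i - x i) := by
        simp only [e, curvePoint, Polynomial.eval_sub, Polynomial.eval_mul, Polynomial.eval_C]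
        rw [mul_sub, mul_div_cancel₀ _ (show q.eval t ≠ 0 from ht)]
        ring
      have h4 := hqw i
      rw [Polynomial.eval_mul] at h4
      calc (w j i).eval t * (e i).eval t
          = (q.eval t * (w j i).eval t) * (curvePoint p q t i - x i) := by rw [h3]; ring
        _ = _ := by
          rw [h4, Finset.sum_mul]
          exact Finset.sum_congr rfl fun k _ => by ring
  have h5 := h.dense hx _ hmem
  rw [hdet] at h5
  simp only [sub_self, mul_zero, Finset.sum_const_zero] at h5
  have : (1 - Matrix.of fun (_ _ : Fin (2 * D + 1)) => (0 : K)) = 1 := by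
    ext; simp
  rw [this, Matrix.det_one] at h5
  exact one_ne_zero h5

/-- The homogeneous parametrization of degree `curveDeg p q` is defined at infinity. -/
theorem exists_coeff_curveDeg_ne_zero (hq : q ≠ 0) :
    q.coeff (curveDeg p q) ≠ 0 ∨ ∃ i, (p i).coeff (curveDeg p q) ≠ 0 := by
  classical
  by_contra! hcon
  have hlt : ∀ f : K[X], f.natDegree ≤ curveDeg p q → f.coeff (curveDeg p q) = 0 →
      f.natDegree < curveDeg p q ∨ f = 0 := by
    intro f hf h0
    rcases hf.lt_or_eq with h | h
    · exact Or.inl h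
    · rw [← h] at h0
      exact Or.inr (Polynomial.leadingCoeff_eq_zero.1 h0)
  have hq' := (hlt q natDegree_denom_le_curveDeg hcon.1).resolve_right hq
  have hp' : (Finset.univ.sup fun i => (p i).natDegree) < curveDeg p q := by
    rw [Finset.sup_lt_iff (lt_of_le_of_lt bot_le hq')]
    intro i _
    rcases hlt (p i) (natDegree_le_curveDeg i) (hcon.2 i) with h | h
    · exact h
    · rw [h]; exact lt_of_le_of_lt (by simp) hq'
  exact absurd (max_lt hq' hp') (lt_irrefl _)

theorem IsCurveParam.finite_diff [IsAlgClosed K] {C : Set (σ → K)} {r : K[X]}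
    (h : IsCurveParam C p q r) : (C \ curvePoint p q '' {t | r.eval t ≠ 0}).Finite := by
  have : Infinite K := IsAlgClosed.instInfinite
  -- The exceptional points are the images of the zeros of `r` and the image of infinity.
  refine (((finite_eval_eq_zero h.r_ne).image (curvePoint p q)).union (Set.finite_singleton
    fun i => (p i).coeff (curveDeg p q) / q.coeff (curveDeg p q))).subset ?_
  rintro x ⟨hx, hxr⟩
  by_cases hex : ∃ t, q.eval t ≠ 0 ∧ curvePoint p q t = x
  · obtain ⟨t, -, rfl⟩ := hex
    left
    refine ⟨t, ?_, rfl⟩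
    by_contra ht
    exact hxr ⟨t, ht, rfl⟩
  · right
    push Not at hex
    have hcoeff := h.coeff_eq hx hex
    have hq : q.coeff (curveDeg p q) ≠ 0 := by
      intro h0
      rcases exists_coeff_curveDeg_ne_zero (p := p) h.q_ne_zero with h1 | ⟨i, hi⟩
      · exact h1 h0
      · exact hi (by rw [hcoeff i, h0, mul_zero])
    rw [Set.mem_singleton_iff]
    funext i
    rw [hcoeff i, mul_div_cancel_right₀ _ hq]

end Degree

end Parametrized

/-! ### Tangent vectors and regular points -/

section Tangent

/-- First-order Taylor expansion; it turns the chain rule along the curve into a substitution in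
`K[ε]`. -/
theorem aeval_dualNumber {K : Type*} [Field K] {σ : Type*} [Fintype σ] (a b : σ → K)
    (f : MvPolynomial σ K) :
    aeval (fun i => (TrivSqZeroExt.inl (a i) + TrivSqZeroExt.inr (b i) : DualNumber K)) f =
      TrivSqZeroExt.inl (eval a f) + TrivSqZeroExt.inr (∑ i, eval a (pderiv i f) * b i) := by
  classical
  induction f using MvPolynomial.induction_on with
  | C c =>
    simp [MvPolynomial.algHom_C, TrivSqZeroExt.algebraMap_eq_inl]
  | add f g hf hg =>
    rw [map_add, hf, hg]
    ext <;> simp [add_mul, Finset.sum_add_distrib]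
  | mul_X f j hf =>
    rw [map_mul, hf, aeval_X]
    ext
    · simp
    · simp only [TrivSqZeroExt.snd_mul, TrivSqZeroExt.fst_add, TrivSqZeroExt.fst_inl,
        TrivSqZeroExt.fst_inr, TrivSqZeroExt.snd_add, TrivSqZeroExt.snd_inl,
        TrivSqZeroExt.snd_inr, add_zero, zero_add, smul_eq_mul, MulOpposite.smul_eq_mul_unop,
        MulOpposite.unop_op, Derivation.leibniz, map_add, map_mul, eval_X, pderiv_X, add_mul,
        Finset.sum_add_distrib, Pi.single_apply, Finset.sum_mul]
      congr 1
      · simp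
      · rw [zero_mul, zero_add]
        exact Finset.sum_congr rfl fun i _ => by ring

variable {K : Type u} [Field K] {σ : Type*} [Fintype σ]

theorem smul_mem_tangentSpaceAt {V : Set (σ → K)} {x y : σ → K} (hy : y ∈ tangentSpaceAt V x)
    (c : K) : (fun i => c * y i) ∈ tangentSpaceAt V x := by
  intro f hf
  have := hy f hf
  calc ∑ i, eval x (pderiv i f) * (c * y i) = c * ∑ i, eval x (pderiv i f) * y i := by
        rw [Finset.mul_sum]; exact Finset.sum_congr rfl fun i _ => by ring
    _ = 0 := by rw [this, mul_zero]

theorem IsCurveParam.curveTangent_mem [Infinite K] {C : Set (σ → K)} {p : σ → Polynomial K}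
    {q r : Polynomial K} (h : IsCurveParam C p q r) {t : K} (ht : q.eval t ≠ 0) :
    curveTangent p q t ∈ tangentSpaceAt C (curvePoint p q t) := by
  intro f hf
  obtain ⟨F, N, hF⟩ := exists_homogenization p q f
  have hF0 : F = 0 := by
    have : F * q = 0 := Polynomial.funext fun s => by
      by_cases hs : q.eval s = 0
      · simp [hs]
      have h1 := hF K (Polynomial.aeval s) (curvePoint p q s) fun i => by
        simp [curvePoint, Polynomial.coe_aeval_eq_eval, div_mul_cancel₀ _ hs]
      rw [hf _ (h.mem s hs), mul_zero, Polynomial.coe_aeval_eq_eval] at h1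
      simp [h1]
    exact (mul_eq_zero.1 this).resolve_right h.q_ne_zero
  -- The numerator of `f` along the curve is the zero polynomial, so it also vanishes at `t + ε`;
  -- there `q` is a unit, and the `ε`-part of `f` is the derivative wanted.
  let τ : DualNumber K := TrivSqZeroExt.inl t + TrivSqZeroExt.inr 1
  have hτ : ∀ g : Polynomial K, Polynomial.aeval τ g =
      TrivSqZeroExt.inl (g.eval t) + TrivSqZeroExt.inr (g.derivative.eval t) := by
    intro g
    have hinl : ∀ g : Polynomial K, Polynomial.aeval (TrivSqZeroExt.inl t : DualNumber K) g =
        TrivSqZeroExt.inl (g.eval t) := fun g => by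
      have := Polynomial.aeval_algebraMap_apply (DualNumber K) t g
      rw [Polynomial.coe_aeval_eq_eval] at this
      simpa [TrivSqZeroExt.algebraMap_eq_inl] using this
    rw [Polynomial.aeval_add_of_sq_eq_zero _ _ _ (by simp [pow_two]), hinl, hinl]
    ext <;> simp
  have h2 := hF (DualNumber K) (Polynomial.aeval τ)
    (fun i => TrivSqZeroExt.inl (curvePoint p q t i) + TrivSqZeroExt.inr (curveTangent p q t i))
    fun i => by
      rw [hτ, hτ]
      ext
      · simp [curvePoint, div_mul_cancel₀ _ ht]
      · simp [curvePoint, curveTangent, Polynomial.wronskian]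
        field_simp
        ring
  rw [hF0, map_zero, aeval_dualNumber, hτ] at h2
  have hu : IsUnit (TrivSqZeroExt.inl (q.eval t) +
      TrivSqZeroExt.inr (q.derivative.eval t) : DualNumber K) := by
    rw [TrivSqZeroExt.isUnit_iff_isUnit_fst]
    simpa using ht
  have h3 := (hu.pow N).mul_right_eq_zero.1 h2.symm
  simpa using congrArg TrivSqZeroExt.snd h3

theorem mem_span_X_sub_C {K σ : Type*} [Field K] (x : σ → K) {f : MvPolynomial σ K} (hf : eval x f = 0) :
    f ∈ Ideal.span (Set.range fun i => X i - C (x i) : Set (MvPolynomial σ K)) := by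
  set J := Ideal.span (Set.range fun i => X i - C (x i) : Set (MvPolynomial σ K))
  have : Ideal.Quotient.mkₐ K J = (Algebra.ofId K _).comp (aeval x) := by
    ext i
    simp only [Ideal.Quotient.mkₐ_eq_mk, AlgHom.comp_apply, aeval_X, Algebra.ofId_apply]
    rw [IsScalarTower.algebraMap_apply K (MvPolynomial σ K) (MvPolynomial σ K ⧸ J)]
    exact Ideal.Quotient.eq.2 (Ideal.subset_span ⟨i, rfl⟩)
  have h1 := DFunLike.congr_fun this f
  rw [← Ideal.Quotient.eq_zero_iff_mem]
  rw [AlgHom.comp_apply, show aeval x f = eval x f from rfl, hf, map_zero] at h1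
  exact h1

/-- Nakayama: if `ξ i = c i * z` with no `c i` a unit, then `I` lies in `𝔪 I`, so `I = 0` and any `ξ
j` will do. -/
theorem exists_eq_span_singleton_of_range {R : Type*} [CommRing R] [IsLocalRing R] {ι : Type*}
    [Nonempty ι] {ξ : ι → R} {I : Ideal R} (hξ : Ideal.span (Set.range ξ) = I) {z : R}
    (hz : Ideal.span {z} = I) : ∃ j, Ideal.span {ξ j} = I := by
  have hmem : ∀ i, ξ i ∈ Ideal.span {z} := fun i => by
    rw [hz, ← hξ]; exact Ideal.subset_span ⟨i, rfl⟩
  choose c hc using fun i => Ideal.mem_span_singleton'.1 (hmem i)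
  by_cases hu : ∃ j, IsUnit (c j)
  · obtain ⟨j, hj⟩ := hu
    refine ⟨j, ?_⟩
    rw [← hc j, Ideal.span_singleton_mul_left_unit hj, hz]
  · push Not at hu
    have hbot : I = ⊥ := by
      refine Submodule.eq_bot_of_le_smul_of_le_jacobson_bot (IsLocalRing.maximalIdeal R) I ?_ ?_ ?_
      · rw [← hz]; exact ⟨{z}, by simp⟩
      · conv_lhs => rw [← hξ]
        rw [Ideal.span_le]
        rintro _ ⟨i, rfl⟩
        rw [← hc i]
        refine Submodule.smul_mem_smul ((IsLocalRing.mem_maximalIdeal _).2 (hu i)) ?_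
        rw [← hz]; exact Ideal.mem_span_singleton_self z
      · exact IsLocalRing.maximalIdeal_le_jacobson _
    obtain ⟨j⟩ := ‹Nonempty ι›
    refine ⟨j, ?_⟩
    have : ξ j ∈ I := by rw [← hξ]; exact Ideal.subset_span ⟨j, rfl⟩
    rw [hbot] at this ⊢
    rw [(Submodule.mem_bot R).1 this]
    simp

/-- Regularity says that the dimension is the least number of generators of the maximal ideal. If no
generator is needed, `z = 0` serves. -/
theorem exists_span_singleton_maximalIdeal {R : Type*} [CommRing R] (hreg : IsRegularLocalRing R)
    (hdim : ringKrullDim R ≤ 1) :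
    ∃ z, Ideal.span {z} = IsLocalRing.maximalIdeal R := by
  have h1 := hreg.spanFinrank_maximalIdeal
  rw [← h1] at hdim
  have h3 : (IsLocalRing.maximalIdeal R).spanFinrank ≤ 1 := by exact_mod_cast hdim
  obtain ⟨s, hs, hspan⟩ := Submodule.FG.exists_span_finset_card_eq_spanFinrank
    ((isNoetherianRing_iff_ideal_fg _).1 inferInstance (IsLocalRing.maximalIdeal R))
  rw [← hs, Finset.card_le_one_iff_subset_singleton] at h3
  obtain ⟨z, hz⟩ := h3
  rcases Finset.subset_singleton_iff.1 hz with h | h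
  · exact ⟨0, by rw [← hspan, h]; simp⟩
  · exact ⟨z, by rw [← hspan, h]; simp⟩

/-- On an irreducible variety of dimension at most one, near a regular point one of the
coordinates is a local parameter. -/
theorem exists_local_parameter [Nonempty σ] {V : Set (σ → K)} (hV : (vanishingIdeal K V).IsPrime)
    (hdim : varietyDim V ≤ 1) (x : V) (hreg : IsRegularLocalRing (LocalRingAt V x)) :
    ∃ (j : σ) (h : MvPolynomial σ K) (u : σ → MvPolynomial σ K), eval (x : σ → K) h ≠ 0 ∧
      ∀ i, h * (X i - C (x.1 i)) - u i * (X j - C (x.1 j)) ∈ vanishingIdeal K V := by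
  have hdim' : ringKrullDim (LocalRingAt V x) ≤ 1 := by
    rw [IsLocalization.AtPrime.ringKrullDim_eq_height (RingHom.ker (evalAtPoint V x))
      (LocalRingAt V x)]
    exact (Ideal.height_le_ringKrullDim_of_ne_top (RingHom.ker_ne_top _)).trans hdim
  obtain ⟨z, hz⟩ := exists_span_singleton_maximalIdeal hreg hdim'
  have hev : ∀ f : MvPolynomial σ K, evalAtPoint V x (Ideal.Quotient.mk _ f) = eval x.1 f :=
    fun f => rfl
  let ξ : σ → LocalRingAt V x := fun i => algebraMap (CoordRing V) _
    (Ideal.Quotient.mk _ (X i - C (x.1 i)))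
  have hker : RingHom.ker (evalAtPoint V x) =
      Ideal.span (Set.range fun i => (Ideal.Quotient.mk (vanishingIdeal K V)) (X i - C (x.1 i))) := by
    apply le_antisymm
    · intro a ha
      obtain ⟨f, rfl⟩ := Ideal.Quotient.mk_surjective a
      have := Ideal.mem_map_of_mem (Ideal.Quotient.mk (vanishingIdeal K V))
        (mem_span_X_sub_C x.1 (f := f) ha)
      rwa [Ideal.map_span, ← Set.range_comp] at this
    · rw [Ideal.span_le]
      rintro _ ⟨i, rfl⟩
      change evalAtPoint V x _ = 0
      rw [hev]
      simp
  have hξ : Ideal.span (Set.range ξ) = IsLocalRing.maximalIdeal (LocalRingAt V x) := by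
    have h1 := Localization.AtPrime.map_eq_maximalIdeal (I := RingHom.ker (evalAtPoint V x))
    conv at h1 => lhs; arg 2; rw [hker]
    rw [Ideal.map_span, ← Set.range_comp] at h1
    exact h1
  obtain ⟨j, hj⟩ := exists_eq_span_singleton_of_range hξ hz
  have hmem : ∀ i, ξ i ∈ Ideal.span {ξ j} := fun i => by
    rw [hj, ← hξ]; exact Ideal.subset_span ⟨i, rfl⟩
  choose c hc using fun i => Ideal.mem_span_singleton'.1 (hmem i)
  -- A common denominator `s` of the `c i`, not vanishing at `x`, lifts to `h`.
  obtain ⟨s, hs⟩ := IsLocalization.exist_integer_multiples_of_finite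
    (RingHom.ker (evalAtPoint V x)).primeCompl c
  choose b hb using hs
  obtain ⟨h, hh⟩ := Ideal.Quotient.mk_surjective (s : CoordRing V)
  choose u hu using fun i => Ideal.Quotient.mk_surjective (b i)
  refine ⟨j, h, u, fun h0 => s.2 ?_, fun i => ?_⟩
  · rw [← hh]; exact h0
  · rw [← Ideal.Quotient.eq_zero_iff_mem]
    have inj : Function.Injective (algebraMap (CoordRing V) (LocalRingAt V x)) :=
      IsLocalization.injective (LocalRingAt V x) (RingHom.ker (evalAtPoint V x)).primeCompl_le_nonZeroDivisors
    apply inj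
    have e1 : algebraMap (CoordRing V) (LocalRingAt V x) (b i) =
      algebraMap (CoordRing V) (LocalRingAt V x) s * c i := by
      rw [hb i, Algebra.smul_def]
    have e2 : c i * ξ j = ξ i := hc i
    rw [map_zero, map_sub, map_mul, map_mul, hh, hu, map_sub, map_mul, map_mul, e1]
    change _ * ξ i - _ * c i * ξ j = 0
    rw [← e2]
    ring

/-- Near a regular point of an irreducible variety of dimension at most one, the tangent spaces
are lines generated by a regular vector field. -/
theorem exists_tangent_frame [Nonempty σ] {V : Set (σ → K)} (hV : (vanishingIdeal K V).IsPrime)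
    (hdim : varietyDim V ≤ 1) (x₀ : V) (hreg : IsRegularLocalRing (LocalRingAt V x₀)) :
    ∃ (j : σ) (H : MvPolynomial σ K) (g : σ → MvPolynomial σ K), eval (x₀ : σ → K) H ≠ 0 ∧
      ∀ x ∈ V, ∀ y ∈ tangentSpaceAt V x, ∀ i, eval x H * y i = y j * eval x (g i) := by
  classical
  obtain ⟨j, h, u, hh, hu⟩ := exists_local_parameter hV hdim x₀ hreg
  -- Differentiating the relations of `exists_local_parameter` along `y` gives `M y = y j • u`. At
  -- `x₀` the matrix is the scalar `h(x₀)`, so its determinant is non-zero there; multiplying by the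
  -- adjugate solves for `y`.
  let M : Matrix σ σ (MvPolynomial σ K) := Matrix.of fun i k =>
    (if i = k then h else 0) + (X i - C (x₀.1 i)) * pderiv k h -
      (X j - C (x₀.1 j)) * pderiv k (u i)
  have hM : ∀ x ∈ V, ∀ y ∈ tangentSpaceAt V x,
      (M.map (eval x)).mulVec y = fun i => y j * eval x (u i) := by
    intro x hx y hy
    funext i
    have h1 := hy _ (hu i)
    have h2 : ∀ k, eval x (pderiv k (h * (X i - C (x₀.1 i)) - u i * (X j - C (x₀.1 j)))) =
        eval x (M i k) - if j = k then eval x (u i) else 0 := by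
      intro k
      simp only [M, Matrix.of_apply, map_sub, Derivation.leibniz, pderiv_X, pderiv_C,
        smul_eq_mul, map_add, map_mul, eval_X, eval_C, Pi.single_apply, sub_zero]
      split_ifs <;> simp only [map_zero, map_one] <;> ring
    simp only [h2, sub_mul, ite_mul, zero_mul, Finset.sum_sub_distrib, Finset.sum_ite_eq,
      Finset.mem_univ, if_true, sub_eq_zero] at h1
    rw [mul_comm (y j), ← h1]
    rfl
  refine ⟨j, M.det, M.adjugate.mulVec u, ?_, fun x hx y hy i => ?_⟩
  · rw [RingHom.map_det]
    have : (eval x₀.1).mapMatrix M = eval x₀.1 h • (1 : Matrix σ σ K) := by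
      ext i k
      by_cases hik : i = k <;> simp [M, hik]
    rw [this, Matrix.det_smul, Matrix.det_one, mul_one]
    exact pow_ne_zero _ hh
  · have h1 := congrArg (fun v => (M.map (eval x)).adjugate.mulVec v i) (hM x hx y hy)
    simp only [Matrix.mulVec_mulVec, Matrix.adjugate_mul, Matrix.smul_mulVec, Matrix.one_mulVec,
      Pi.smul_apply, smul_eq_mul] at h1
    rw [RingHom.map_det]
    refine h1.trans ?_
    have h2 : (M.map (eval x)).adjugate = M.adjugate.map (eval x) :=
      ((eval x).map_adjugate M).symm
    rw [h2]
    simp only [Matrix.mulVec, dotProduct, Matrix.map_apply, map_sum, map_mul, Finset.mul_sum]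
    exact Finset.sum_congr rfl fun k _ => by ring

end Tangent

/-! ### Irreducibility and dimension of the tangent bundle -/

section TangentBundle


theorem isAlgVariety_tangentBundle {K : Type*} [Field K] {σ : Type*} [Fintype σ]
    {V : Set (σ → K)} (hV : IsAlgVariety V) : IsAlgVariety (tangentBundle V) := by
  refine subset_antisymm (fun z hz => ⟨?_, ?_⟩) (zeroLocus_vanishingIdeal_le _)
  · rw [← hV]
    intro f hf
    have h1 := hz (rename Sum.inl f) fun w hw => by
      rw [aeval_rename]
      exact hf _ hw.1
    rw [aeval_rename] at h1
    exact h1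
  · intro f hf
    have key : ∀ w : σ ⊕ σ → K, aeval w (∑ i, rename Sum.inl (pderiv i f) * X (Sum.inr i)) =
        ∑ i, eval (fun i => w (Sum.inl i)) (pderiv i f) * w (Sum.inr i) := by
      intro w
      simp only [map_sum, map_mul, aeval_rename, aeval_X]
      rfl
    rw [← key z]
    refine hz _ fun w hw => ?_
    rw [key]
    exact hw.2 f hf


theorem ringKrullDim_le_of_isIntegral {R S : Type*} [CommRing R] [CommRing S] [Algebra R S]
    [Algebra.IsIntegral R S] : ringKrullDim S ≤ ringKrullDim R := by
  refine Order.krullDim_le_of_strictMono (PrimeSpectrum.comap (algebraMap R S)) ?_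
  intro I J hIJ
  exact Ideal.IsIntegral.comap_lt_comap (R := R) (I := I.asIdeal) (J := J.asIdeal) hIJ

/-- A finitely generated algebra of rational functions in `m` variables has dimension at
most `m`. -/
theorem ringKrullDim_quotient_ker_le {K : Type u} [Field K] {τ : Type*} [Finite τ] {m : ℕ}
    (φ : MvPolynomial τ K →ₐ[K] FractionRing (MvPolynomial (Fin m) K))
    (I : Ideal (MvPolynomial τ K)) (hI : I = RingHom.ker φ) :
    ringKrullDim (MvPolynomial τ K ⧸ I) ≤ m := by
  subst hI
  have hp : (RingHom.ker φ).IsPrime := RingHom.ker_isPrime _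
  -- Noether normalization bounds the dimension by `s`, and `s` algebraically independent elements
  -- of a field of transcendence degree `m` force `s ≤ m`.
  obtain ⟨s, g, hg, hint⟩ :=
    exists_integral_inj_algHom_of_fg K (MvPolynomial τ K ⧸ RingHom.ker φ)
  have h1 : ringKrullDim (MvPolynomial τ K ⧸ RingHom.ker φ) ≤ s := by
    algebraize [g.toRingHom]
    refine (ringKrullDim_le_of_isIntegral (R := MvPolynomial (Fin s) K)).trans ?_
    rw [MvPolynomial.ringKrullDim_of_isNoetherianRing, ringKrullDim_eq_zero_of_field]
    simp
  have h2 : s ≤ m := by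
    let ψ : MvPolynomial (Fin s) K →ₐ[K] FractionRing (MvPolynomial (Fin m) K) :=
      (Ideal.kerLiftAlg φ).comp g
    have hψ : Function.Injective ψ := (Ideal.kerLiftAlg_injective φ).comp hg
    have h3 := trdeg_add_eq K (MvPolynomial (Fin m) K)
      (A := FractionRing (MvPolynomial (Fin m) K))
    have h4 := trdeg_le_of_injective ψ hψ
    have : Algebra.IsAlgebraic (MvPolynomial (Fin m) K) (FractionRing (MvPolynomial (Fin m) K)) :=
      IsLocalization.isAlgebraic _ (nonZeroDivisors (MvPolynomial (Fin m) K))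
    rw [trdeg_eq_zero (R := MvPolynomial (Fin m) K), add_zero] at h3
    rw [← h3, MvPolynomial.trdeg_of_isDomain, MvPolynomial.trdeg_of_isDomain] at h4
    simpa using h4
  exact h1.trans (by exact_mod_cast h2)

variable {K : Type u} [Field K] {n : ℕ}

/-- The point `(P(t), s P'(t))` of the tangent bundle of the curve parametrized by `P = p / q`. -/
def tangentPoint (p : Fin n → Polynomial K) (q : Polynomial K) (t s : K) : Fin n ⊕ Fin n → K :=
  Sum.elim (curvePoint p q t) fun i => s * curveTangent p q t i

/-- Every point of `V` has a neighbourhood in which the tangent spaces are contained in the lines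
generated by a regular vector field. -/
def HasTangentFrames (V : Set (Fin n → K)) : Prop :=
  ∀ x₀ ∈ V, ∃ (j : Fin n) (H : MvPolynomial (Fin n) K) (g : Fin n → MvPolynomial (Fin n) K),
    eval x₀ H ≠ 0 ∧ ∀ x ∈ V, ∀ y ∈ tangentSpaceAt V x, ∀ i, eval x H * y i = y j * eval x (g i)

theorem isPrime_vanishingIdeal_line [Infinite K] {τ : Type*} (a b : τ → K) :
    (vanishingIdeal K (Set.range fun s : K => fun i => a i + s * b i)).IsPrime := by
  have : vanishingIdeal K (Set.range fun s : K => fun i => a i + s * b i) =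
      RingHom.ker (aeval (R := K) fun i =>
        (Polynomial.C (a i) + Polynomial.X * Polynomial.C (b i) : Polynomial K)) := by
    ext f
    have key : ∀ s : K, Polynomial.eval s (aeval (R := K) (fun i =>
        (Polynomial.C (a i) + Polynomial.X * Polynomial.C (b i) : Polynomial K)) f) =
        aeval (fun i => a i + s * b i) f := by
      intro s
      have : ((Polynomial.aeval s).comp (aeval (R := K) fun i =>
        (Polynomial.C (a i) + Polynomial.X * Polynomial.C (b i) : Polynomial K))) =
          aeval (fun i => a i + s * b i) := by
        ext i
        simp only [AlgHom.comp_apply, aeval_X, map_add, map_mul, Polynomial.aeval_X,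
          Polynomial.aeval_C, Algebra.algebraMap_self, RingHom.id_apply]
      exact DFunLike.congr_fun this f
    rw [RingHom.mem_ker, mem_vanishingIdeal_iff, Set.forall_mem_range]
    constructor
    · intro h0
      exact Polynomial.funext fun s => by rw [key, h0, Polynomial.eval_zero]
    · intro h0 s
      rw [← key, h0, Polynomial.eval_zero]
  rw [this]
  exact RingHom.ker_isPrime _

namespace IsCurveParam

variable {C : Set (Fin n → K)} {p : Fin n → Polynomial K} {q r : Polynomial K}

theorem tangentPoint_mem [Infinite K] (h : IsCurveParam C p q r) {t : K} (ht : q.eval t ≠ 0)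
    (s : K) : tangentPoint p q t s ∈ tangentBundle C :=
  ⟨h.mem t ht, smul_mem_tangentSpaceAt (h.curveTangent_mem ht) s⟩

/-- The parametrized points are dense in the tangent bundle. -/
theorem vanishingIdeal_tangentBundle [Infinite K] (h : IsCurveParam C p q r)
    (hC : HasTangentFrames C) : vanishingIdeal K (tangentBundle C) =
      vanishingIdeal K (Set.range fun z : {t // r.eval t ≠ 0} × K =>
        tangentPoint p q z.1 z.2) := by
  apply le_antisymm
  · apply vanishingIdeal_anti_mono
    rintro _ ⟨z, rfl⟩
    exact h.tangentPoint_mem (h.q_ne _ z.1.2) _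
  intro f hf z hz
  obtain ⟨j, H, g, hH, hg⟩ := hC _ hz.1
  set x : Fin n → K := fun i => z (Sum.inl i) with hx
  set y : Fin n → K := fun i => z (Sum.inr i) with hy
  obtain ⟨S, M, hS⟩ := exists_numerator (p := p) (q := q) H
  have hS0 : S ≠ 0 := by
    rintro rfl
    refine hH ?_
    refine h.mem_vanishingIdeal (f := H) one_ne_zero (fun t _ ht => ?_) x hz.1
    have := hS t (h.q_ne t ht)
    rw [Polynomial.eval_zero, eq_comm, mul_eq_zero] at this
    exact this.resolve_left (pow_ne_zero _ (h.q_ne t ht))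
  have hHS : ∀ t, r.eval t ≠ 0 → S.eval t ≠ 0 → eval (curvePoint p q t) H ≠ 0 := by
    intro t ht hSt h0
    apply hSt
    rw [hS t (h.q_ne t ht), show aeval (curvePoint p q t) H = eval (curvePoint p q t) H from rfl,
      h0, mul_zero]
  -- In a frame the `j`-th coordinate controls the whole tangent vector, so it cannot vanish
  -- identically along the curve.
  have hw : Polynomial.wronskian q (p j) ≠ 0 := by
    intro hw
    obtain ⟨t, ht⟩ := exists_eval_ne_zero (mul_ne_zero h.r_ne hS0)
    rw [Polynomial.eval_mul] at ht
    have hrt := left_ne_zero_of_mul ht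
    refine h.tangent t hrt (funext fun i => ?_)
    have h1 := hg _ (h.mem t (h.q_ne t hrt)) _ (h.curveTangent_mem (h.q_ne t hrt)) i
    have h2 : curveTangent p q t j = 0 := by simp [curveTangent, hw]
    rw [h2, zero_mul, mul_eq_zero] at h1
    exact h1.resolve_left (hHS t hrt (right_ne_zero_of_mul ht))
  -- Extend `y` to the tangent field with constant `j`-th coordinate `y j` and other coordinates `y
  -- j * g i / H`. Then `f` becomes a function `F` of the base point alone. It vanishes at almost
  -- all `P(t)`, on choosing `s` with `s P'(t)_j = y j`, hence on all of `C`, in particular at `x`.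
  obtain ⟨F, N, hF⟩ := exists_homogenization (K := K)
    (Sum.elim (fun i => X i * H) fun i => MvPolynomial.C (y j) * g i) H f
  have hF' : ∀ (a : Fin n → K) (w : Fin n ⊕ Fin n → K), (∀ i, w (Sum.inl i) = a i) →
      (∀ i, eval a H * w (Sum.inr i) = y j * eval a (g i)) →
      aeval a F = eval a H ^ N * aeval w f := by
    intro a w h1 h2
    refine hF K (aeval a) w ?_
    rintro (i | i)
    · simp [h1]
    · simpa [mul_comm] using h2 i
  have hFC : F ∈ vanishingIdeal K C := by
    refine h.mem_vanishingIdeal (mul_ne_zero hS0 hw) fun t ht hrt => ?_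
    rw [Polynomial.eval_mul] at ht
    have hqt := h.q_ne t hrt
    have hj : curveTangent p q t j ≠ 0 :=
      div_ne_zero (right_ne_zero_of_mul ht) (pow_ne_zero _ hqt)
    rw [hF' (curvePoint p q t) (tangentPoint p q t (y j / curveTangent p q t j)) (fun i => rfl),
      hf _ ⟨(⟨t, hrt⟩, _), rfl⟩, mul_zero]
    intro i
    have h1 := hg _ (h.mem t hqt) _ (smul_mem_tangentSpaceAt (h.curveTangent_mem hqt)
      (y j / curveTangent p q t j)) i
    rw [div_mul_cancel₀ _ hj] at h1
    exact h1
  have h1 := hF' x z (fun i => rfl) (hg x hz.1 y hz.2)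
  rw [hFC x hz.1, eq_comm, mul_eq_zero] at h1
  exact h1.resolve_left (pow_ne_zero _ hH)

/-- The two variables are `t` and `s`. This embedding of the coordinate ring in `K(t, s)` yields
both primality and the bound 2 on the dimension. -/
theorem vanishingIdeal_tangentBundle_eq_ker [Infinite K] (h : IsCurveParam C p q r)
    (hC : HasTangentFrames C) :
    ∃ φ : MvPolynomial (Fin n ⊕ Fin n) K →ₐ[K] FractionRing (MvPolynomial (Fin 2) K),
      vanishingIdeal K (tangentBundle C) = RingHom.ker φ := by
  let ρ : Polynomial K →ₐ[K] MvPolynomial (Fin 2) K := Polynomial.aeval (X 0)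
  let ψ : {t // r.eval t ≠ 0} × K → MvPolynomial (Fin 2) K →ₐ[K] K := fun z =>
    aeval ![(z.1 : K), z.2]
  have hρ : ∀ (f : Polynomial K) (a : Fin 2 → K), eval a (ρ f) = f.eval (a 0) := by
    intro f a
    have : ((aeval a).comp ρ) = Polynomial.aeval (a 0) := by
      ext; simp [ρ]
    exact DFunLike.congr_fun this f
  -- The base coordinates are written `p i * q / q ^ 2` to share the denominator of the tangent
  -- coordinates.
  refine ⟨_, (h.vanishingIdeal_tangentBundle hC).trans (Eq.trans ?_ (vanishingIdeal_range_eq_ker ψ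
    ?_ (Sum.elim (fun i => ρ (p i * q)) fun i => X 1 * ρ (Polynomial.wronskian q (p i)))
    (ρ (q ^ 2)) ?_))⟩
  · congr 2
    funext z
    have hq := h.q_ne _ z.1.2
    have hψ : ∀ f : Polynomial K, ψ z (ρ f) = f.eval (z.1 : K) := fun f => hρ f _
    funext i
    rcases i with i | i
    · simp only [tangentPoint, Sum.elim_inl, hψ, curvePoint, Polynomial.eval_mul,
        Polynomial.eval_pow]
      field_simp
    · simp only [tangentPoint, Sum.elim_inr, hψ, curveTangent, map_mul, Polynomial.eval_pow]
      simp [ψ, mul_div_assoc]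
  · intro b hb
    have h1 : b * ρ r = 0 := MvPolynomial.funext fun a => by
      by_cases ha : r.eval (a 0) = 0
      · simp [hρ, ha]
      · have := hb (⟨a 0, ha⟩, a 1)
        have e : ![a 0, a 1] = a := by ext i; fin_cases i <;> rfl
        simp only [ψ, e] at this
        rw [map_mul, show eval a b = aeval a b from rfl, this, zero_mul, map_zero]
    refine (mul_eq_zero.1 h1).resolve_right fun h0 => ?_
    obtain ⟨t, ht⟩ := exists_eval_ne_zero h.r_ne
    have := hρ r ![t, 0]
    rw [h0, map_zero] at this
    exact ht this.symm
  · intro z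
    have : ψ z (ρ (q ^ 2)) = (q ^ 2).eval (z.1 : K) := hρ _ _
    rw [this, Polynomial.eval_pow]
    exact pow_ne_zero _ (h.q_ne _ z.1.2)

theorem isIrredVariety_tangentBundle [Infinite K] (h : IsCurveParam C p q r)
    (hC : HasTangentFrames C) : IsIrredVariety (tangentBundle C) := by
  refine ⟨isAlgVariety_tangentBundle h.closed, ?_⟩
  obtain ⟨φ, hφ⟩ := h.vanishingIdeal_tangentBundle_eq_ker hC
  rw [hφ]
  exact RingHom.ker_isPrime _

theorem varietyDim_tangentBundle [Infinite K] (h : IsCurveParam C p q r)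
    (hC : HasTangentFrames C) : varietyDim (tangentBundle C) = 2 := by
  obtain ⟨φ, hφ⟩ := h.vanishingIdeal_tangentBundle_eq_ker hC
  refine le_antisymm (ringKrullDim_quotient_ker_le φ _ hφ) ?_
  obtain ⟨t, ht⟩ := exists_eval_ne_zero h.r_ne
  obtain ⟨t', ht'⟩ := exists_eval_ne_zero
    (mul_ne_zero h.r_ne (Polynomial.X_sub_C_ne_zero t))
  rw [Polynomial.eval_mul] at ht'
  have hrt' := left_ne_zero_of_mul ht'
  have htt' : t' ≠ t := by
    rintro rfl
    exact right_ne_zero_of_mul ht' (by simp)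
  set x := curvePoint p q t with hx
  set v := curveTangent p q t with hv
  have hxy : curvePoint p q t' ≠ x := fun h0 => htt' (h.inj hrt' ht h0)
  obtain ⟨i, hi⟩ := Function.ne_iff.1 hxy
  obtain ⟨k, hk⟩ := Function.ne_iff.1 (h.tangent t ht)
  set L : Set (Fin n ⊕ Fin n → K) :=
    Set.range fun s : K => fun i => (Sum.elim x 0 : Fin n ⊕ Fin n → K) i + s * (Sum.elim 0 v : Fin n ⊕ Fin n → K) i with hL
  have hLeq : ∀ s : K, (fun i => (Sum.elim x 0 : Fin n ⊕ Fin n → K) i + s * (Sum.elim 0 v : Fin n ⊕ Fin n → K) i) =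
      tangentPoint p q t s := by
    intro s
    ext (i | i) <;> simp [tangentPoint, hx, hv]
  have hLT : L ⊆ tangentBundle C := by
    rintro _ ⟨s, rfl⟩
    beta_reduce
    rw [hLeq]
    exact h.tangentPoint_mem (h.q_ne t ht) s
  have hLp : (vanishingIdeal K L).IsPrime := isPrime_vanishingIdeal_line _ _
  have hpt : tangentPoint p q t 0 ∈ L := ⟨0, hLeq 0⟩
  -- Lower bound: the chain of a point, the tangent line over one base point, and the whole bundle.
  let Z := PrimeSpectrum.zeroLocus
    (vanishingIdeal K (tangentBundle C) : Set (MvPolynomial (Fin n ⊕ Fin n) K))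
  let I0 : Z := ⟨⟨_, (h.isIrredVariety_tangentBundle hC).2⟩, fun _ h => h⟩
  let I1 : Z := ⟨⟨_, hLp⟩, fun _ h => vanishingIdeal_anti_mono hLT h⟩
  let I2 : Z := ⟨⟨vanishingIdeal K {tangentPoint p q t 0}, inferInstance⟩,
    fun _ h => vanishingIdeal_anti_mono (Set.singleton_subset_iff.2 (hLT hpt)) h⟩
  have h01 : I0 < I1 := by
    refine lt_of_le_not_ge (vanishingIdeal_anti_mono hLT) fun hle => ?_
    have hmem : (X (Sum.inl i) - MvPolynomial.C (x i) : MvPolynomial (Fin n ⊕ Fin n) K) ∈ vanishingIdeal K L := by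
      rintro _ ⟨s, rfl⟩
      simp
    have := hle hmem _ (h.tangentPoint_mem (h.q_ne t' hrt') 0)
    simp only [map_sub, aeval_X, tangentPoint, Sum.elim_inl, algHom_C] at this
    exact hi (sub_eq_zero.1 this)
  have h12 : I1 < I2 := by
    refine lt_of_le_not_ge (vanishingIdeal_anti_mono (Set.singleton_subset_iff.2 hpt))
      fun hle => ?_
    have hmem : (X (Sum.inr k) : MvPolynomial (Fin n ⊕ Fin n) K) ∈
        vanishingIdeal K {tangentPoint p q t 0} := by
      rintro _ rfl
      simp [tangentPoint]
    have := hle hmem _ ⟨1, rfl⟩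
    exact hk (by simpa using this)
  let s : LTSeries Z :=
    { length := 2
      toFun := (![I0, I1, I2] : Fin 3 → Z)
      step := by
        intro i
        fin_cases i
        · exact h01
        · exact h12 }
  rw [varietyDim, ringKrullDim_quotient]
  exact Order.LTSeries.length_le_krullDim s

end IsCurveParam

end TangentBundle

/-! ### Pencils of polynomials and Wronskians -/

section Counting

variable {K : Type*} [Field K] {τ : Type*}

theorem generic_linear_ne_zero {ι : Type*} [Fintype ι] {e : ι → τ} (he : Function.Injective e)
    {c : ι → K} (hc : c ≠ 0) : Generic fun a : τ → K => ∑ i, a (e i) * c i ≠ 0 := by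
  classical
  obtain ⟨i, hi⟩ := Function.ne_iff.1 hc
  have key : ∀ a : τ → K, eval a (∑ i, X (e i) * C (c i)) = ∑ i, a (e i) * c i := fun a => by simp
  refine (generic_eval_ne_zero (F := ∑ i, X (e i) * C (c i)) (Pi.single (e i) 1) ?_).mono
    fun a ha => by rwa [key] at ha
  rw [key, Finset.sum_eq_single i]
  · simpa using hi
  · intro k _ hk
    simp [he.ne hk]
  · simp

theorem generic_affine_ne_zero {ι : Type*} [Fintype ι] {e : Option ι → τ}
    (he : Function.Injective e) (x : ι → K) :
    Generic fun a : τ → K => a (e none) + ∑ i, a (e (some i)) * x i ≠ 0 := by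
  have := generic_linear_ne_zero he (c := fun o => o.elim 1 x)
    (fun h => by simpa using congrFun h none)
  simpa [Fintype.sum_option] using this

open Polynomial in
/-- All but finitely many members of a pencil of polynomials are separable of full degree, without
roots in a given finite set. -/
theorem finite_pencil_ncard_ne [IsAlgClosed K] {g q r : K[X]} {D : ℕ} (hr : r ≠ 0)
    (hg : g.natDegree ≤ D) (hq : q.natDegree ≤ D) (hD : q.coeff D ≠ 0 ∨ g.coeff D ≠ 0)
    (hw : wronskian q g ≠ 0) (hgq : ∀ t, q.eval t = 0 → g.eval t ≠ 0) :
    {c : K | ¬ {t | (g + Polynomial.C c * q).eval t = 0 ∧ r.eval t ≠ 0}.ncard = D}.Finite := by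
  -- Excluded are the values of `-g / q` at its critical points and at the zeros of `r`, and its
  -- value at infinity, where the degree would drop. If `q.coeff D = 0`, the latter reads 0, a
  -- harmless extra exclusion.
  refine (((finite_eval_eq_zero (mul_ne_zero hw hr)).image fun t => -(g.eval t / q.eval t)).union
    (Set.finite_singleton (-(g.coeff D / q.coeff D)))).subset fun c hc => ?_
  by_contra hcon
  simp only [Set.mem_union, Set.mem_image, Set.mem_ofPred_eq, Set.mem_singleton_iff, not_or,
    not_exists, not_and, Polynomial.eval_mul, mul_eq_zero] at hcon
  obtain ⟨h1, h2⟩ := hcon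
  apply hc
  set f := g + Polynomial.C c * q with hf
  have hroot : ∀ t, f.eval t = 0 → q.eval t ≠ 0 ∧ c = -(g.eval t / q.eval t) := by
    intro t ht
    have hqt : q.eval t ≠ 0 := fun h0 => hgq t h0 (by simpa [hf, h0] using ht)
    refine ⟨hqt, ?_⟩
    simp only [hf, Polynomial.eval_add, Polynomial.eval_mul, Polynomial.eval_C] at ht
    field_simp
    linear_combination ht
  have hcoeff : f.coeff D ≠ 0 := by
    intro h0
    simp only [hf, Polynomial.coeff_add, Polynomial.coeff_C_mul] at h0
    by_cases hqD : q.coeff D = 0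
    · rw [hqD, mul_zero, add_zero] at h0
      exact hD.elim (fun h => h hqD) fun h => h h0
    · apply h2
      field_simp
      linear_combination h0
  have hdeg : f.natDegree = D := by
    refine le_antisymm ?_ (Polynomial.le_natDegree_of_ne_zero hcoeff)
    exact (Polynomial.natDegree_add_le _ _).trans
      (max_le hg ((Polynomial.natDegree_C_mul_le _ _).trans hq))
  have hsep : f.Separable := by
    refine (Polynomial.isCoprime_iff_aeval_ne_zero_of_isAlgClosed K K _ _).2 fun t => ?_
    simp only [Polynomial.coe_aeval_eq_eval]
    by_contra! hcon
    obtain ⟨hqt, hct⟩ := hroot t hcon.1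
    refine h1 t (Or.inl ?_) hct.symm
    have h3 := hcon.1
    have h4 := hcon.2
    simp only [hf, Polynomial.derivative_add, Polynomial.derivative_mul, Polynomial.derivative_C,
      zero_mul, zero_add, Polynomial.eval_add, Polynomial.eval_mul, Polynomial.eval_C] at h3 h4
    simp only [wronskian, Polynomial.eval_sub, Polynomial.eval_mul]
    -- The Wronskian of `q` with `g + c q` does not depend on `c`, so a multiple root is a zero of
    -- it.
    linear_combination q.eval t * h4 - (derivative q).eval t * h3
  rw [show {t | f.eval t = 0 ∧ r.eval t ≠ 0} = {t | f.eval t = 0} from ?_,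
    ncard_roots_of_separable hsep, hdeg]
  ext t
  refine ⟨fun h => h.1, fun h => ⟨h, fun hrt => ?_⟩⟩
  exact h1 t (Or.inr hrt) (hroot t h).2.symm

-- The Wronskian has degree less than the sum of the two degrees. Subtracting a multiple of `p` from
-- `q` leaves it unchanged and removes the term of degree `D`, which gains one more.
open Polynomial in
theorem natDegree_wronskian_le {p q : K[X]} {D : ℕ} (hp : p.natDegree ≤ D) (hq : q.natDegree ≤ D) :
    (wronskian q p).natDegree ≤ 2 * D - 2 := by
  by_cases hw : wronskian q p = 0
  · simp [hw]
  by_cases hpD : p.coeff D = 0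
  · have h1 := natDegree_wronskian_lt_add hw
    by_cases hpd : p.natDegree = D
    · rw [← hpd] at hpD
      rw [Polynomial.coeff_natDegree, Polynomial.leadingCoeff_eq_zero] at hpD
      simp [hpD, wronskian] at hw
    · omega
  · set c := q.coeff D / p.coeff D
    have h0 : wronskian (q - Polynomial.C c * p) p = wronskian q p := by
      simp [wronskian]
      ring
    rw [← h0] at hw ⊢
    have h1 := natDegree_wronskian_lt_add hw
    have h2 : (q - Polynomial.C c * p).natDegree ≤ D := (Polynomial.natDegree_sub_le _ _).trans
      (max_le hq ((Polynomial.natDegree_C_mul_le _ _).trans hp))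
    have h3 : (q - Polynomial.C c * p).coeff D = 0 := by
      simp [c, div_mul_cancel₀ _ hpD]
    by_cases hpd : (q - Polynomial.C c * p).natDegree = D
    · rw [← hpd] at h3
      rw [Polynomial.coeff_natDegree, Polynomial.leadingCoeff_eq_zero] at h3
      simp [h3, wronskian] at hw
    · omega

end Counting

/-! ### Linear combinations with indeterminate coefficients -/

section LinearForms

open Polynomial

variable {K : Type*} [Field K] {τ ι : Type*} [Fintype ι]

/-- The linear combination of the polynomials `w i` with the coefficients `e i` as variables. -/
def genericCombination (e : ι → τ) (w : ι → K[X]) : (MvPolynomial τ K)[X] :=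
  ∑ i, Polynomial.C (MvPolynomial.X (e i)) * (w i).map MvPolynomial.C

theorem map_genericCombination (e : ι → τ) (w : ι → K[X]) (a : τ → K) :
    (genericCombination e w).map (MvPolynomial.eval a) = ∑ i, Polynomial.C (a (e i)) * w i := by
  have : (MvPolynomial.eval a).comp MvPolynomial.C = RingHom.id K := by ext; simp
  simp [genericCombination, Polynomial.map_sum, Polynomial.map_map, this]

theorem eval_map_genericCombination (e : ι → τ) (w : ι → K[X]) (a : τ → K) (t : K) :
    ((genericCombination e w).map (MvPolynomial.eval a)).eval t =
      ∑ i, a (e i) * (w i).eval t := by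
  simp [map_genericCombination, Polynomial.eval_finsetSum]

theorem natDegree_map_genericCombination_le (e : ι → τ) {w : ι → K[X]} {D : ℕ}
    (hw : ∀ i, (w i).natDegree ≤ D) (a : τ → K) :
    ((genericCombination e w).map (MvPolynomial.eval a)).natDegree ≤ D := by
  rw [map_genericCombination]
  exact Polynomial.natDegree_sum_le_of_forall_le _ _ fun i _ =>
    (Polynomial.natDegree_C_mul_le _ _).trans (hw i)

theorem genericCombination_ne_zero [Infinite K] {e : ι → τ} (he : Function.Injective e)
    {w : ι → K[X]} {t : K} (hw : (fun i => (w i).eval t) ≠ 0) : genericCombination e w ≠ 0 := by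
  intro h0
  obtain ⟨a, ha⟩ := (generic_linear_ne_zero he hw).exists
  rw [← eval_map_genericCombination, h0] at ha
  simp at ha

theorem eval_map_map_C (f : K[X]) (a : τ → K) :
    (f.map (MvPolynomial.C (σ := τ))).map (MvPolynomial.eval a) = f := by
  have : (MvPolynomial.eval a).comp MvPolynomial.C = RingHom.id K := by ext; simp
  rw [Polynomial.map_map, this, Polynomial.map_id]

end LinearForms

/-! ### The degree of the curve -/

section CurveDegree

variable {K : Type u} [Field K] {n : ℕ}

namespace IsCurveParam

variable {C : Set (Fin n → K)} {p : Fin n → Polynomial K} {q r : Polynomial K} {τ : Type*}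

theorem exists_wronskian_ne_zero (h : IsCurveParam C p q r) {t : K} (ht : r.eval t ≠ 0) :
    ∃ i, (Polynomial.wronskian q (p i)).eval t ≠ 0 := by
  by_contra! hcon
  exact h.tangent t ht (funext fun i => by simp [curveTangent, hcon i])

theorem generic_ncard_curve [IsAlgClosed K] [CharZero K] (h : IsCurveParam C p q r)
    {e : Option (Fin n) → τ} (he : Function.Injective e) :
    Generic fun a : τ → K =>
      {t | q.eval t * a (e none) + ∑ i, a (e (some i)) * (p i).eval t = 0 ∧ r.eval t ≠ 0}.Finite ∧
      {t | q.eval t * a (e none) + ∑ i, a (e (some i)) * (p i).eval t = 0 ∧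
        r.eval t ≠ 0}.ncard = curveDeg p q := by
  classical
  have : Infinite K := IsAlgClosed.instInfinite
  let w : Option (Fin n) → Polynomial K := fun o => o.elim q p
  obtain ⟨t₀, ht₀⟩ := exists_eval_ne_zero h.r_ne
  obtain ⟨i₀, hw₀⟩ := h.exists_wronskian_ne_zero ht₀
  have hne : genericCombination e w ≠ 0 := by
    refine genericCombination_ne_zero he (t := t₀) fun h0 => ?_
    exact h.q_ne t₀ ht₀ (congrFun h0 none)
  obtain ⟨δ, hδ⟩ := generic_ncard_roots_diff hne (r.map MvPolynomial.C)
  have hev : ∀ (a : τ → K) t, ((genericCombination e w).map (MvPolynomial.eval a)).eval t =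
      q.eval t * a (e none) + ∑ i, a (e (some i)) * (p i).eval t := by
    intro a t
    rw [eval_map_genericCombination, Fintype.sum_option, mul_comm]
    rfl
  simp only [hev, eval_map_map_C] at hδ
  have hes : Function.Injective fun i => e (some i) := he.comp (Option.some_injective _)
  have hD : δ = curveDeg p q := by
    have g1 : Generic fun a : τ → K => ∀ t ∈ {t | q.eval t = 0},
        ∑ i, a (e (some i)) * (p i).eval t ≠ 0 := by
      refine Generic.forall_mem_finite (finite_eval_eq_zero h.q_ne_zero) fun t ht => ?_
      obtain ⟨i, hi⟩ := h.no_common t ht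
      exact generic_linear_ne_zero hes fun h0 => hi (congrFun h0 i)
    have g2 : Generic fun a : τ → K =>
        ∑ i, a (e (some i)) * (Polynomial.wronskian q (p i)).eval t₀ ≠ 0 :=
      generic_linear_ne_zero hes fun h0 => hw₀ (congrFun h0 i₀)
    have g3 : Generic fun a : τ → K => q.coeff (curveDeg p q) ≠ 0 ∨
        ∑ i, a (e (some i)) * (p i).coeff (curveDeg p q) ≠ 0 := by
      rcases exists_coeff_curveDeg_ne_zero (p := p) h.q_ne_zero with h1 | ⟨i, hi⟩
      · exact ⟨1, one_ne_zero, fun _ _ => Or.inl h1⟩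
      · exact (generic_linear_ne_zero hes fun h0 => hi (congrFun h0 i)).mono fun a ha => Or.inr ha
    -- The generic count `δ` is found on a pencil in which only the constant coefficient moves: all
    -- but finitely many members have `δ` roots, and all but finitely many have `curveDeg p q`.
    obtain ⟨a, hfin, h1, h2, h3⟩ :=
      ((hδ.finite_not_update (e none)).and (g1.and (g2.and g3))).exists
    set g : Polynomial K := ∑ i, Polynomial.C (a (e (some i))) * p i with hg
    have hgev : ∀ t, g.eval t = ∑ i, a (e (some i)) * (p i).eval t := fun t => by
      simp [hg, Polynomial.eval_finsetSum]
    have hfin' := finite_pencil_ncard_ne (g := g) (q := q) (D := curveDeg p q) h.r_ne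
      (Polynomial.natDegree_sum_le_of_forall_le _ _ fun i _ =>
        (Polynomial.natDegree_C_mul_le _ _).trans (natDegree_le_curveDeg i))
      natDegree_denom_le_curveDeg (by simpa [hg, Polynomial.finsetSum_coeff] using h3)
      (fun h0 => h2 ?_) (fun t ht => by rw [hgev]; exact h1 t ht)
    · obtain ⟨c, hc⟩ := (hfin.union hfin').exists_notMem
      simp only [Set.mem_union, Set.mem_ofPred_eq, not_or, not_not] at hc
      obtain ⟨⟨-, hc1⟩, hc2⟩ := hc
      rw [← hc1, ← hc2]
      congr 1
      ext t
      have : ∀ i, Function.update a (e none) c (e (some i)) = a (e (some i)) := fun i =>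
        Function.update_of_ne (he.ne (by simp)) _ _
      simp [this, hgev, add_comm, mul_comm c]
    · have h4 : (Polynomial.wronskian q g).eval t₀ =
          ∑ i, a (e (some i)) * (Polynomial.wronskian q (p i)).eval t₀ := by
        simp only [Polynomial.wronskian, hg, Polynomial.derivative_sum, Polynomial.eval_sub,
          Polynomial.eval_mul, Polynomial.eval_finsetSum, Polynomial.derivative_C_mul,
          Polynomial.eval_C, Finset.mul_sum, ← Finset.sum_sub_distrib]
        exact Finset.sum_congr rfl fun i _ => by ring
      rw [← h4, h0, Polynomial.eval_zero]
  rwa [hD] at hδ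

theorem isDegreeOfIrred [IsAlgClosed K] [CharZero K] (h : IsCurveParam C p q r)
    (hdim : varietyDim C = 1) : IsDegreeOfIrred C (curveDeg p q) := by
  classical
  have : Infinite K := IsAlgClosed.instInfinite
  refine ⟨1, by simpa using hdim, ?_⟩
  have he : Function.Injective fun o : Option (Fin n) => ((0 : Fin 1), o) := fun _ _ h => by
    simpa using h
  obtain ⟨t₀, ht₀⟩ := exists_eval_ne_zero h.r_ne
  obtain ⟨i₀, hw₀⟩ := h.exists_wronskian_ne_zero ht₀
  have g1 := h.generic_ncard_curve he
  -- A generic hyperplane avoids the finitely many points not parametrized off the zeros of `r`.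
  have g2 := Generic.forall_mem_finite h.finite_diff fun x _ => generic_affine_ne_zero he x
  have g3 := generic_eval_ne_zero (K := K) (F := X ((0 : Fin 1), some i₀)) (fun _ => 1) (by simp)
  obtain ⟨F, hF, H⟩ := g1.and (g2.and g3)
  refine ⟨F, hF, fun a ha => ?_⟩
  obtain ⟨⟨hfin, hcard⟩, hS, ha₀⟩ := H _ ha
  refine ⟨?_, ?_⟩
  · rw [linearIndependent_unique_iff]
    intro h0
    exact ha₀ (by simpa using congrFun h0 i₀)
  · have himg : C ∩ linearSection a = curvePoint p q '' {t | q.eval t * a 0 none +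
        ∑ i, a 0 (some i) * (p i).eval t = 0 ∧ r.eval t ≠ 0} := by
      have key : ∀ t, q.eval t ≠ 0 → q.eval t * a 0 none + ∑ i, a 0 (some i) * (p i).eval t =
          q.eval t * (a 0 none + ∑ i, a 0 (some i) * curvePoint p q t i) := by
        intro t ht
        rw [mul_add, Finset.mul_sum]
        congr 1
        refine Finset.sum_congr rfl fun i _ => ?_
        rw [curvePoint]
        field_simp
      ext x
      constructor
      · rintro ⟨hx, hxa⟩
        have hxa0 := hxa 0
        by_cases hxS : x ∈ C \ curvePoint p q '' {t | r.eval t ≠ 0}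
        · exact absurd hxa0 (hS x hxS)
        · obtain ⟨t, ht, rfl⟩ : x ∈ curvePoint p q '' {t | r.eval t ≠ 0} := by
            by_contra hx'
            exact hxS ⟨hx, hx'⟩
          refine ⟨t, ⟨?_, ht⟩, rfl⟩
          rw [key t (h.q_ne t ht), hxa0, mul_zero]
      · rintro ⟨t, ⟨ht, hrt⟩, rfl⟩
        refine ⟨h.mem t (h.q_ne t hrt), fun i => ?_⟩
        rw [key t (h.q_ne t hrt), mul_eq_zero] at ht
        rw [Subsingleton.elim i 0]
        exact ht.resolve_left (h.q_ne t hrt)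
    rw [himg]
    refine ⟨hfin.image _, ?_⟩
    rw [(h.inj.mono fun t ht => ht.2).ncard_image]
    exact hcard

end IsCurveParam

end CurveDegree

/-! ### The degree of the tangent bundle -/

section TangentDegree

variable {K : Type u} [Field K] {n : ℕ}

theorem HasTangentFrames.exists_smul {C : Set (Fin n → K)} (hC : HasTangentFrames C)
    {x y₀ y : Fin n → K} (hx : x ∈ C) (hy₀ : y₀ ∈ tangentSpaceAt C x) (h₀ : y₀ ≠ 0)
    (hy : y ∈ tangentSpaceAt C x) : ∃ c : K, y = c • y₀ := by
  obtain ⟨j, H, g, hH, hg⟩ := hC x hx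
  have h1 := hg x hx y₀ hy₀
  have h2 := hg x hx y hy
  have hj : y₀ j ≠ 0 := by
    intro h0
    refine h₀ (funext fun i => ?_)
    have := h1 i
    rw [h0, zero_mul] at this
    exact (mul_eq_zero.1 this).resolve_left hH
  refine ⟨y j / y₀ j, funext fun i => mul_left_cancel₀ hH ?_⟩
  simp only [Pi.smul_apply, smul_eq_mul]
  rw [h2 i, mul_left_comm, h1 i, ← mul_assoc, div_mul_cancel₀ _ hj]

theorem HasTangentFrames.exists_span {C : Set (Fin n → K)} [NeZero n] (hC : HasTangentFrames C)
    {x : Fin n → K} (hx : x ∈ C) : ∃ v : Fin n → K, v ≠ 0 ∧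
      ∀ y ∈ tangentSpaceAt C x, ∃ c : K, y = c • v := by
  by_cases hex : ∃ v ∈ tangentSpaceAt C x, v ≠ 0
  · obtain ⟨v, hv, hv0⟩ := hex
    exact ⟨v, hv0, fun y hy => hC.exists_smul hx hv hv0 hy⟩
  · push Not at hex
    -- If the tangent space is zero, any non-zero vector will do.
    refine ⟨fun _ => 1, fun h0 => one_ne_zero (congrFun h0 0), fun y hy => ⟨0, ?_⟩⟩
    rw [zero_smul, hex y hy]

/-- The coefficients of the part of the `k`-th equation in the coordinates of the base point. -/
def baseIndex (k : Fin 2) (o : Option (Fin n)) : Fin 2 × Option (Fin n ⊕ Fin n) :=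
  (k, o.map Sum.inl)

/-- The coefficients of the part of the `k`-th equation in the coordinates of the tangent vector. -/
def fibreIndex (k : Fin 2) (i : Fin n) : Fin 2 × Option (Fin n ⊕ Fin n) :=
  (k, some (Sum.inr i))

theorem fibreIndex_injective (k : Fin 2) : Function.Injective (fibreIndex (n := n) k) := by
  intro i i' h
  simpa [fibreIndex] using h

/-- This is the determinant of the two equations in `c` at the point `(x, c v)`. When it is non-zero
they have no common solution, so the section misses the line over `x`. -/
theorem generic_fibre_ne_zero (x : Fin n → K) {v : Fin n → K} (hv : v ≠ 0) :
    Generic fun a : Fin 2 × Option (Fin n ⊕ Fin n) → K =>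
      (a (0, none) + ∑ i, a (0, some (Sum.inl i)) * x i) * ∑ i, a (1, some (Sum.inr i)) * v i -
      (a (1, none) + ∑ i, a (1, some (Sum.inl i)) * x i) * ∑ i, a (0, some (Sum.inr i)) * v i ≠ 0 := by
  classical
  obtain ⟨i₀, hi₀⟩ := Function.ne_iff.1 hv
  let F : MvPolynomial (Fin 2 × Option (Fin n ⊕ Fin n)) K :=
    (X (0, none) + ∑ i, X (0, some (Sum.inl i)) * C (x i)) * ∑ i, X (1, some (Sum.inr i)) * C (v i) -
      (X (1, none) + ∑ i, X (1, some (Sum.inl i)) * C (x i)) * ∑ i, X (0, some (Sum.inr i)) * C (v i)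
  have key : ∀ a, eval a F =
      (a (0, none) + ∑ i, a (0, some (Sum.inl i)) * x i) * ∑ i, a (1, some (Sum.inr i)) * v i -
      (a (1, none) + ∑ i, a (1, some (Sum.inl i)) * x i) * ∑ i, a (0, some (Sum.inr i)) * v i :=
    fun a => by simp [F]
  refine (generic_eval_ne_zero (F := F)
    (Pi.single (0, none) 1 + Pi.single (1, some (Sum.inr i₀)) 1) ?_).mono fun a ha => by
      rwa [key] at ha
  rw [key]
  simpa [Pi.single_apply] using hi₀

theorem generic_linearIndependent [NeZero n] :
    Generic fun a : Fin 2 × Option (Fin n ⊕ Fin n) → K =>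
      LinearIndependent K fun (i : Fin 2) (j : Fin n ⊕ Fin n) => a (i, some j) := by
  have i₀ : Fin n := 0
  have key := generic_eval_ne_zero (K := K) (F := X ((0 : Fin 2), some (Sum.inl i₀)) *
    X ((1 : Fin 2), some (Sum.inr i₀)) - X ((0 : Fin 2), some (Sum.inr i₀)) *
    X ((1 : Fin 2), some (Sum.inl i₀)))
    (fun z => if z = (0, some (Sum.inl i₀)) ∨ z = (1, some (Sum.inr i₀)) then 1 else 0) (by simp)
  refine key.mono fun a ha => ?_
  simp only [map_sub, map_mul, eval_X] at ha
  rw [Fintype.linearIndependent_iff]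
  intro c hc
  rw [Fin.sum_univ_two] at hc
  have h1 := congrFun hc (Sum.inl i₀)
  have h2 := congrFun hc (Sum.inr i₀)
  simp only [Pi.add_apply, Pi.smul_apply, smul_eq_mul, Pi.zero_apply] at h1 h2
  rw [Fin.forall_fin_two]
  constructor
  · refine (mul_eq_zero.1 ?_).resolve_right ha
    linear_combination a (1, some (Sum.inr i₀)) * h1 - a (1, some (Sum.inl i₀)) * h2
  · refine (mul_eq_zero.1 ?_).resolve_right ha
    linear_combination a (0, some (Sum.inl i₀)) * h2 - a (0, some (Sum.inr i₀)) * h1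

open Polynomial

/-- The `k`-th equation at `(P(t), 0)`, for `P = p / q`, multiplied by `q`. -/
def baseForm (p : Fin n → K[X]) (q : K[X]) (k : Fin 2) :
    (MvPolynomial (Fin 2 × Option (Fin n ⊕ Fin n)) K)[X] :=
  genericCombination (baseIndex k) fun o => o.elim q p

/-- The linear part of the `k`-th equation at `(0, P'(t))`, for `P = p / q`, multiplied by
`q ^ 2`. -/
def fibreForm (p : Fin n → K[X]) (q : K[X]) (k : Fin 2) :
    (MvPolynomial (Fin 2 × Option (Fin n ⊕ Fin n)) K)[X] :=
  genericCombination (fibreIndex k) fun i => wronskian q (p i)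

/-- The result of eliminating `s` from the two equations at `(P(t), s P'(t))`. -/
def eliminant (p : Fin n → K[X]) (q : K[X]) :
    (MvPolynomial (Fin 2 × Option (Fin n ⊕ Fin n)) K)[X] :=
  baseForm p q 0 * fibreForm p q 1 - baseForm p q 1 * fibreForm p q 0

variable {p : Fin n → K[X]} {q r : K[X]} {C : Set (Fin n → K)}

theorem natDegree_map_eliminant_le (a : Fin 2 × Option (Fin n ⊕ Fin n) → K) :
    ((eliminant p q).map (MvPolynomial.eval a)).natDegree ≤
      curveDeg p q + (2 * curveDeg p q - 2) := by
  have hA : ∀ k, ((baseForm p q k).map (MvPolynomial.eval a)).natDegree ≤ curveDeg p q := fun k => by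
    refine natDegree_map_genericCombination_le _ ?_ a
    rintro (_ | i)
    · exact natDegree_denom_le_curveDeg
    · exact natDegree_le_curveDeg i
  have hB : ∀ k, ((fibreForm p q k).map (MvPolynomial.eval a)).natDegree ≤ 2 * curveDeg p q - 2 :=
    fun k => natDegree_map_genericCombination_le _
      (fun i => natDegree_wronskian_le (natDegree_le_curveDeg i) natDegree_denom_le_curveDeg) a
  rw [eliminant, Polynomial.map_sub, Polynomial.map_mul, Polynomial.map_mul]
  exact (Polynomial.natDegree_sub_le _ _).trans (max_le
    (Polynomial.natDegree_mul_le.trans (add_le_add (hA _) (hB _)))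
    (Polynomial.natDegree_mul_le.trans (add_le_add (hA _) (hB _))))

theorem eval_baseForm (a : Fin 2 × Option (Fin n ⊕ Fin n) → K) (k : Fin 2) (t : K) :
    ((baseForm p q k).map (MvPolynomial.eval a)).eval t =
      a (k, none) * q.eval t + ∑ i, a (k, some (Sum.inl i)) * (p i).eval t := by
  rw [baseForm, eval_map_genericCombination, Fintype.sum_option]
  rfl

theorem eval_fibreForm (a : Fin 2 × Option (Fin n ⊕ Fin n) → K) (k : Fin 2) (t : K) :
    ((fibreForm p q k).map (MvPolynomial.eval a)).eval t =
      ∑ i, a (k, some (Sum.inr i)) * (wronskian q (p i)).eval t := by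
  rw [fibreForm, eval_map_genericCombination]
  rfl

theorem mul_equation_tangentPoint (a : Fin 2 × Option (Fin n ⊕ Fin n) → K) (k : Fin 2) {t : K}
    (ht : q.eval t ≠ 0) (s : K) :
    q.eval t ^ 2 * (a (k, none) + ∑ j, a (k, some j) * tangentPoint p q t s j) =
      q.eval t * ((baseForm p q k).map (MvPolynomial.eval a)).eval t +
        s * ((fibreForm p q k).map (MvPolynomial.eval a)).eval t := by
  rw [eval_baseForm, eval_fibreForm, Fintype.sum_sum_type]
  simp only [tangentPoint, Sum.elim_inl, Sum.elim_inr, curvePoint, curveTangent]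
  simp only [mul_add, Finset.mul_sum]
  rw [add_assoc]
  congr 1
  · ring
  · congr 1 <;> refine Finset.sum_congr rfl fun i _ => ?_ <;> field_simp

namespace IsCurveParam

theorem fibreForm_ne_zero [Infinite K] (h : IsCurveParam C p q r) (k : Fin 2) :
    fibreForm p q k ≠ 0 := by
  obtain ⟨t, ht⟩ := exists_eval_ne_zero h.r_ne
  obtain ⟨i, hi⟩ := h.exists_wronskian_ne_zero ht
  exact genericCombination_ne_zero (fibreIndex_injective k) (t := t)
    fun h0 => hi (congrFun h0 i)

theorem eliminant_ne_zero [Infinite K] (h : IsCurveParam C p q r) : eliminant p q ≠ 0 := by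
  obtain ⟨t, ht⟩ := exists_eval_ne_zero h.r_ne
  have hq := h.q_ne t ht
  obtain ⟨a, ha⟩ := (generic_fibre_ne_zero (curvePoint p q t) (h.tangent t ht)).exists
  intro h0
  have h1 := congrArg (fun f => (f.map (MvPolynomial.eval a)).eval t) h0
  simp only [eliminant, Polynomial.map_sub, Polynomial.map_mul, Polynomial.eval_sub,
    Polynomial.eval_mul, eval_baseForm, eval_fibreForm, Polynomial.map_zero,
    Polynomial.eval_zero] at h1
  have hA : ∀ k, a (k, none) + ∑ i, a (k, some (Sum.inl i)) * curvePoint p q t i =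
      (a (k, none) * q.eval t + ∑ i, a (k, some (Sum.inl i)) * (p i).eval t) / q.eval t := by
    intro k
    rw [add_div, mul_div_cancel_right₀ _ hq, Finset.sum_div]
    congr 1
    exact Finset.sum_congr rfl fun i _ => by rw [curvePoint, mul_div_assoc]
  have hB : ∀ k, ∑ i, a (k, some (Sum.inr i)) * curveTangent p q t i =
      (∑ i, a (k, some (Sum.inr i)) * (wronskian q (p i)).eval t) / q.eval t ^ 2 := by
    intro k
    rw [Finset.sum_div]
    exact Finset.sum_congr rfl fun i _ => by rw [curveTangent, mul_div_assoc]
  rw [hA, hA, hB, hB] at ha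
  apply ha
  rw [div_mul_div_comm, div_mul_div_comm, ← sub_div, h1, zero_div]

/-- For generic equations, the linear forms on the tangent line and the affine forms on the curve
have no common zeros. -/
theorem generic_no_common_zero [IsAlgClosed K] [CharZero K] (h : IsCurveParam C p q r) :
    Generic fun a : Fin 2 × Option (Fin n ⊕ Fin n) → K => ∀ t, r.eval t ≠ 0 →
      ((fibreForm p q 0).map (MvPolynomial.eval a)).eval t = 0 →
      ((baseForm p q 0).map (MvPolynomial.eval a)).eval t ≠ 0 := by
  classical
  have : Infinite K := IsAlgClosed.instInfinite
  -- The number of common zeros is generically constant, so one suitable choice without any settles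
  -- it. The fibre form does not involve the coefficient `(0, none)`, which can be moved so that the
  -- base form avoids its finitely many zeros.
  obtain ⟨δ, hδ⟩ := generic_ncard_common_roots_diff (h.fibreForm_ne_zero 0) (baseForm p q 0)
    (r.map MvPolynomial.C)
  simp only [eval_map_map_C] at hδ
  obtain ⟨t₀, ht₀⟩ := exists_eval_ne_zero h.r_ne
  obtain ⟨i₀, hi₀⟩ := h.exists_wronskian_ne_zero ht₀
  have g := generic_linear_ne_zero (fibreIndex_injective (n := n) 0)
    (c := fun i => (wronskian q (p i)).eval t₀) fun h0 => hi₀ (congrFun h0 i₀)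
  obtain ⟨a, hfin, ha⟩ := ((hδ.finite_not_update (0, none)).and g).exists
  rw [← eval_map_genericCombination (fibreIndex 0) (fun i => wronskian q (p i))] at ha
  have hB0 : (fibreForm p q 0).map (MvPolynomial.eval a) ≠ 0 := by
    intro h0
    rw [fibreForm] at h0
    rw [h0] at ha
    simp at ha
  have hfin' := (finite_eval_eq_zero hB0).image fun t =>
    -((∑ i, a (0, some (Sum.inl i)) * (p i).eval t) / q.eval t)
  obtain ⟨c, hc⟩ := (hfin.union hfin').exists_notMem
  obtain ⟨-, hc1⟩ := not_not.1 fun h => hc (Or.inl h)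
  have hc2 := fun t ht e => hc (Or.inr ⟨t, ht, e⟩)
  have hδ0 : δ = 0 := by
    rw [← hc1]
    convert Set.ncard_empty K
    rw [Set.eq_empty_iff_forall_notMem]
    rintro t ⟨h1, h2, h3⟩
    have hqt := h.q_ne t h3
    simp only [eval_fibreForm, eval_baseForm, Function.update_self, ne_eq, Prod.mk.injEq,
      reduceCtorEq, and_false, not_false_eq_true, Function.update_of_ne] at h1 h2
    refine hc2 t (by rw [Set.mem_ofPred_eq, eval_fibreForm]; exact h1) ?_
    beta_reduce
    field_simp
    linear_combination -h2
  refine hδ.mono fun a ⟨hf, hn⟩ t hrt h1 h2 => ?_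
  rw [hδ0, Set.ncard_eq_zero hf] at hn
  exact Set.eq_empty_iff_forall_notMem.1 hn t ⟨h1, h2, hrt⟩

theorem exists_isDegreeOfIrred_tangentBundle [IsAlgClosed K] [CharZero K] [NeZero n]
    (h : IsCurveParam C p q r) (hC : HasTangentFrames C) :
    ∃ δ ≤ curveDeg p q + (2 * curveDeg p q - 2), IsDegreeOfIrred (tangentBundle C) δ := by
  classical
  have : Infinite K := IsAlgClosed.instInfinite
  obtain ⟨δ, g1⟩ := generic_ncard_roots_diff h.eliminant_ne_zero
    (fibreForm p q 0 * r.map MvPolynomial.C)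
  obtain ⟨_, g2⟩ := generic_ncard_roots h.eliminant_ne_zero
  have g3 := h.generic_no_common_zero
  choose! v hv0 hv using fun x hx => hC.exists_span (x := x) hx
  -- No point of the section lies over the finitely many exceptional points of `C`.
  have g4 := Generic.forall_mem_finite h.finite_diff
    fun x hx => generic_fibre_ne_zero x (hv0 x hx.1)
  have g5 := generic_linearIndependent (K := K) (n := n)
  have g := g1.and (g2.and (g3.and (g4.and g5)))
  have hle : δ ≤ curveDeg p q + (2 * curveDeg p q - 2) := by
    obtain ⟨a, ⟨-, rfl⟩, ⟨h2, -⟩, -⟩ := g.exists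
    refine (Set.ncard_le_ncard (fun t ht => ?_) (finite_eval_eq_zero h2)).trans
      ((ncard_eval_eq_zero_le h2).trans (natDegree_map_eliminant_le a))
    exact ht.1
  refine ⟨δ, hle, 2, by rw [h.varietyDim_tangentBundle hC]; rfl, ?_⟩
  obtain ⟨F, hF, H⟩ := g
  refine ⟨F, hF, fun a ha => ?_⟩
  obtain ⟨⟨hfin, hcard⟩, -, hcommon, hS, hind⟩ := H _ ha
  refine ⟨hind, ?_⟩
  set b : Fin 2 × Option (Fin n ⊕ Fin n) → K := fun z => a z.1 z.2 with hb
  set A : Fin 2 → K → K := fun k t => ((baseForm p q k).map (MvPolynomial.eval b)).eval t with hA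
  set B : Fin 2 → K → K := fun k t => ((fibreForm p q k).map (MvPolynomial.eval b)).eval t with hB
  have hG : ∀ t, ((eliminant p q).map (MvPolynomial.eval b)).eval t =
      A 0 t * B 1 t - A 1 t * B 0 t := fun t => by simp [eliminant, hA, hB]
  have hBr : ∀ t, ((fibreForm p q 0 * r.map MvPolynomial.C).map (MvPolynomial.eval b)).eval t =
      B 0 t * r.eval t := fun t => by
    rw [Polynomial.map_mul, eval_map_map_C, Polynomial.eval_mul]
  simp only [hG, hBr] at hfin hcard
  have hlin : ∀ k t s, q.eval t ≠ 0 →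
      (a k none + ∑ j, a k (some j) * tangentPoint p q t s j = 0 ↔
        q.eval t * A k t + s * B k t = 0) := by
    intro k t s ht
    rw [← mul_equation_tangentPoint b k ht s, mul_eq_zero, or_iff_right (pow_ne_zero 2 ht)]
  -- Since `A 0` and `B 0` have no common zero off the zeros of `r`, every solution has `B 0 t ≠ 0`,
  -- and the first equation gives `s`; the second then becomes the eliminant.
  have himg : tangentBundle C ∩ linearSection a =
      (fun t => tangentPoint p q t (-(q.eval t * A 0 t / B 0 t))) ''
        {t | A 0 t * B 1 t - A 1 t * B 0 t = 0 ∧ B 0 t * r.eval t ≠ 0} := by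
    ext z
    constructor
    · rintro ⟨hz, hza⟩
      have hx : (fun i => z (Sum.inl i)) ∈ C := hz.1
      by_cases hxS : (fun i => z (Sum.inl i)) ∈ C \ curvePoint p q '' {t | r.eval t ≠ 0}
      · exfalso
        obtain ⟨c, hc⟩ := hv _ hx _ hz.2
        have e : ∀ k, (b (k, none) + ∑ i, b (k, some (Sum.inl i)) * z (Sum.inl i)) +
            c * ∑ i, b (k, some (Sum.inr i)) * v (fun i => z (Sum.inl i)) i = 0 := by
          intro k
          have h1 := hza k
          rw [Fintype.sum_sum_type, ← add_assoc] at h1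
          rw [Finset.mul_sum, ← h1]
          congr 1
          refine Finset.sum_congr rfl fun i _ => ?_
          have h2 := congrFun hc i
          simp only [Pi.smul_apply, smul_eq_mul] at h2
          rw [h2]
          ring
        refine hS _ hxS ?_
        linear_combination (∑ i, b (1, some (Sum.inr i)) * v (fun i => z (Sum.inl i)) i) * e 0 -
          (∑ i, b (0, some (Sum.inr i)) * v (fun i => z (Sum.inl i)) i) * e 1
      · obtain ⟨t, ht, htx⟩ : (fun i => z (Sum.inl i)) ∈ curvePoint p q '' {t | r.eval t ≠ 0} := by
          by_contra hx'
          exact hxS ⟨hx, hx'⟩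
        have hqt := h.q_ne t ht
        have hzT := hz.2
        rw [← htx] at hzT
        obtain ⟨s, hs⟩ := hC.exists_smul (h.mem t hqt) (h.curveTangent_mem hqt)
          (h.tangent t ht) hzT
        have hzt : z = tangentPoint p q t s := by
          ext (i | i)
          · exact (congrFun htx i).symm
          · exact congrFun hs i
        have e : ∀ k, q.eval t * A k t + s * B k t = 0 := fun k => by
          rw [← hlin k t s hqt, ← hzt]
          exact hza k
        have hB0 : B 0 t ≠ 0 := by
          intro h0
          have := e 0
          rw [h0, mul_zero, add_zero, mul_eq_zero] at this
          exact hcommon t ht h0 (this.resolve_left hqt)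
        refine ⟨t, ⟨?_, mul_ne_zero hB0 ht⟩, ?_⟩
        · refine (mul_eq_zero.1 ?_).resolve_left hqt
          linear_combination B 1 t * e 0 - B 0 t * e 1
        · have hs' : -(q.eval t * A 0 t / B 0 t) = s := by
            field_simp
            linear_combination -e 0
          rw [hzt, ← hs']
    · rintro ⟨t, ⟨hGt, hBt⟩, rfl⟩
      have hB0 := left_ne_zero_of_mul hBt
      have hqt := h.q_ne t (right_ne_zero_of_mul hBt)
      refine ⟨h.tangentPoint_mem hqt _, fun k => (hlin k t _ hqt).2 ?_⟩
      have e : ∀ k, A k t * B 0 t = A 0 t * B k t := by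
        rw [Fin.forall_fin_two]
        exact ⟨rfl, by linear_combination -hGt⟩
      field_simp
      linear_combination q.eval t * e k
  rw [himg]
  refine ⟨hfin.image _, ?_⟩
  rw [Set.InjOn.ncard_image, hcard]
  intro t ht t' ht' htt'
  refine h.inj (right_ne_zero_of_mul ht.2) (right_ne_zero_of_mul ht'.2) (funext fun i => ?_)
  exact congrFun htt' (Sum.inl i)

/-- Constant `p` and `q` have zero Wronskians. Positivity makes the truncated `2 * curveDeg p q - 2`
an honest difference. -/
theorem curveDeg_pos [Infinite K] (h : IsCurveParam C p q r) : 0 < curveDeg p q := by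
  obtain ⟨t, ht⟩ := exists_eval_ne_zero h.r_ne
  obtain ⟨i, hi⟩ := h.exists_wronskian_ne_zero ht
  by_contra h0
  have hq := natDegree_denom_le_curveDeg (p := p) (q := q)
  have hp := natDegree_le_curveDeg (p := p) (q := q) i
  refine hi ?_
  rw [wronskian, Polynomial.derivative_of_natDegree_zero (p := q) (by omega),
    Polynomial.derivative_of_natDegree_zero (p := p i) (by omega)]
  simp

end IsCurveParam

theorem isGeometricDegree_of_isIrredVariety {K : Type*} [Field K] {σ : Type*} [Fintype σ]
    {V : Set (σ → K)} {δ : ℕ} (hV : IsIrredVariety V) (h : IsDegreeOfIrred V δ) :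
    IsGeometricDegree V δ := by
  refine ⟨hV.1, ?_, fun _ => δ, ?_, ?_⟩
  all_goals rw [irredComponents_of_isIrredVariety hV]
  · exact Set.finite_singleton V
  · rintro Z rfl
    exact h
  · rw [finsum_mem_singleton]

end TangentDegree

end

theorem mainTheorem5 {K : Type*} [Field K] [IsAlgClosed K] [CharZero K] {n : ℕ}
    (C : Set (Fin n → K)) (hC : IsAlgCurve C) (hsmooth : IsSmoothVariety C)
    (P : Fin n → RatFunc K) (hP : IsRatParametrization P C) (hP12 : SatisfiesP1P2 P) :
    ∃ degC degTC : ℕ, IsGeometricDegree C degC ∧ IsGeometricDegree (tangentBundle C) degTC ∧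
      (degTC : ℤ) ≤ 3 * (degC : ℤ) - 2 := by
  have : Infinite K := IsAlgClosed.instInfinite
  obtain ⟨p, q, r, h⟩ := exists_isCurveParam hC.1 hP hP12
  -- Being parametrized, `C` is irreducible and hence its own only component.
  have hdim : varietyDim C = 1 := hC.2 C (by
    rw [irredComponents_of_isIrredVariety h.isIrredVariety]
    exact Set.mem_singleton C)
  obtain ⟨t, ht⟩ := exists_eval_ne_zero h.r_ne
  obtain ⟨i, -⟩ := h.exists_wronskian_ne_zero ht
  have : NeZero n := ⟨i.pos.ne'⟩
  have hframes : HasTangentFrames C := fun x hx =>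
    exists_tangent_frame h.isPrime hdim.le ⟨x, hx⟩ (hsmooth ⟨x, hx⟩)
  obtain ⟨δ, hδ, hdeg⟩ := h.exists_isDegreeOfIrred_tangentBundle hframes
  refine ⟨curveDeg p q, δ, isGeometricDegree_of_isIrredVariety h.isIrredVariety
    (h.isDegreeOfIrred hdim), isGeometricDegree_of_isIrredVariety
    (h.isIrredVariety_tangentBundle hframes) hdeg, ?_⟩
  have := h.curveDeg_pos
  omega
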